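/- **Theorem 1.** For strings $x,y$ over a finite alphabet $\Sigma$, the *site-directed insertion* (SDI) of $y$ into $x$ is $$x \stackrel{\rm sdi}{\leftarrow} y = \{\, x_1 u z v x_2 \mid x = x_1 u v x_2,\ y = u z v,\ u \neq \varepsilon,\ v \neq \varepsilon \,\},$$ and the *alphabetic site-directed insertion* is $$x \stackrel{\rm a\text{-}sdi}{\leftarrow} y = \{\, x_1 a z b x_2 \mid x = x_1 a b x_2,\ y = a z b,\ a,b\in\Sigma,\ x_1,x_2,z\in\Sigma^* \,\}.$$ Either operation $\odot$ is extended to languages by $L_1 \odot L_2 = \bigcup_{w_1\in L_1,\, w_2\in L_2} w_1 \odot w_2$. A language $L\subseteq\Sigma^*$ is *$\odot$-free* with respect to $R\subseteq\Sigma^*$ if $L \odot R = \emptyset$, and *$\odot$-independent* with respect to $R$ if $(L \odot \Sigma^+) \cap R = \emptyset$. It is called SDI-free or SDI-independent if $\odot$ is the site-directed insertion, and alphabetic SDI-free or alphabetic SDI-independent if $\odot$ is the alphabetic one. Each of the following four problems is decidable in polynomial time. The input consists of two nondeterministic finite automata $A$ and $B$ over a common finite alphabet $\Sigma$, where the alphabet,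 the sets of states, and the automata are all part of the input. 1. Is $L(A)$ SDI-free with respect to $L(B)$? Is $L(A)$ SDI-independent with respect to $L(B)$? 2. Is $L(A)$ alphabetic SDI-free with respect to $L(B)$? Is $L(A)$ alphabetic SDI-independent with respect to $L(B)$? Here "in polynomial time" means: by a multi-stack Turing machine whose number of steps is bounded by a polynomial in the length of the binary description of $(A,B)$. The description gives the number of letters and the numbers of states of $A$ and $B$ in unary, followed, for each automaton, by its transition table, its set of initial states and its set of final states, written out as bits. An NFA may have any set of initial states; a single initial state is a special case. -/

import Mathlib

open Computability

namespace SDI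

section Operations

variable {α : Type*}

/-- Site-directed insertion of the string `y` into the string `x`: a nontrivial outfix `(u, v)` of
`y = u z v` is matched with a substring `u v` of `x`, and the strings `x₁ u z v x₂` result. -/
def sdi (x y : List α) : Language α :=
  {w | ∃ x₁ u z v x₂ : List α, x = x₁ ++ u ++ v ++ x₂ ∧ y = u ++ z ++ v ∧ u ≠ [] ∧ v ≠ [] ∧
    w = x₁ ++ u ++ z ++ v ++ x₂}

/-- Alphabetic site-directed insertion: the matched prefix and suffix of the inserted string are
single letters. -/
def alphabeticSdi (x y : List α) : Language α :=
  {w | ∃ (x₁ : List α) (a : α) (z : List α) (b : α) (x₂ : List α),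
    x = x₁ ++ [a] ++ [b] ++ x₂ ∧ y = [a] ++ z ++ [b] ∧ w = x₁ ++ [a] ++ z ++ [b] ++ x₂}

/-- Extension of an operation on strings to languages: the union of `op x y` over all
`x ∈ L₁` and `y ∈ L₂`. -/
def liftOp (op : List α → List α → Language α) (L₁ L₂ : Language α) : Language α :=
  {w | ∃ x ∈ L₁, ∃ y ∈ L₂, w ∈ op x y}

/-- `Σ⁺`, the language of all nonempty strings. -/
def nonemptyStrings (α : Type*) : Language α := {w | w ≠ []}

/-- `L` is `op`-free with respect to `R`: `L op R = ∅`. -/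
def IsFree (op : List α → List α → Language α) (L R : Language α) : Prop :=
  liftOp op L R = ⊥

/-- `L` is `op`-independent with respect to `R`: `(L op Σ⁺) ∩ R = ∅`. -/
def IsIndependent (op : List α → List α → Language α) (L R : Language α) : Prop :=
  liftOp op L (nonemptyStrings α) ⊓ R = ⊥

end Operations

/-- An instance of the decision problems: two finite NFAs over a common finite alphabet. The
alphabet and the state sets are part of the input and are numbered. -/
structure NFAPair where
  /-- the number of letters -/
  letters : ℕ
  /-- the number of states of the first automaton -/
  statesA : ℕ
  /-- the number of states of the second automaton -/
  statesB : ℕ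
  /-- the first automaton -/
  A : NFA (Fin letters) (Fin statesA)
  /-- the second automaton -/
  B : NFA (Fin letters) (Fin statesB)

open Classical in
/-- The characteristic bits of a subset of `Fin n`. -/
noncomputable def setBits {n : ℕ} (S : Set (Fin n)) : List Bool :=
  (List.finRange n).map fun q => decide (q ∈ S)

/-- The description of an NFA by bits: the transition table (for each state `p` and each letter `a`
the characteristic bits of the set of successors), the initial states, the final states. -/
noncomputable def nfaBits {k n : ℕ} (M : NFA (Fin k) (Fin n)) : List Bool :=
  ((List.finRange n).flatMap fun p => (List.finRange k).flatMap fun a => setBits (M.step p a)) ++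
    setBits M.start ++ setBits M.accept

/-- The self-delimiting unary code `1ⁿ0`. -/
def unaryCode (n : ℕ) : List Bool := List.replicate n true ++ [false]

/-- The binary string that describes a pair of NFAs. -/
noncomputable def NFAPair.encode (I : NFAPair) : List Bool :=
  unaryCode I.letters ++ unaryCode I.statesA ++ unaryCode I.statesB ++ nfaBits I.A ++ nfaBits I.B

/-- The property `P` of objects described by strings through `enc` is decidable in polynomial time:
some Turing machine, given `enc a`, halts within a number of steps that is polynomial in the length
of `enc a`, with the output `true` if `P a` holds and `false` otherwise. -/
def DecidableInPolyTime {β Γ : Type} (enc : β → List Γ) (P : β → Prop) : Prop :=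
  ∃ f : β → Bool, (∀ b, f b = true ↔ P b) ∧
    Nonempty (Turing.TM2ComputableInPolyTime enc encodeBool f)

end SDI

/-! Every violation of freeness or independence is a pair of words that the two automata can read
side by side, with a fixed pattern of phases. For freeness `A` reads `x₁` alone, both read `u`, `B`
reads `z` alone, both read `v`, and `A` reads `x₂` alone. For independence the inserted word is
arbitrary and `B` reads the result, so both read `x₁ u`, `B` reads `z` alone, and both read `v x₂`.
There all but the last letter of `u` may be shifted into `x₁` and all but the first letter of `v`
into `x₂`, so one matched letter on each side suffices and the two operations have the same
independence problem. Thus each property says that no accepting vertex is reachable in a graph on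
phases and pairs of states (`isFree_sdi_iff`, `isFree_alphabeticSdi_iff`, `isIndependent_sdi_iff`,
`isIndependent_alphabeticSdi_iff`).

Reachability is found by saturation: a sweep over all rules and moves marks a new vertex unless the
marked set is already the full closure. With six tables and `n`, `m` states, `6 * n * m` sweeps
suffice (`Progress.den`, `mem_bits_den_search`).

The time bound on a Turing machine is obtained through two intermediate languages. Commands `Cmd`
have bounded loops and address bits by polynomials in the loop variables. For a fixed command the
nesting depth is fixed, so it becomes a stack program with a polynomial bound on its running time
(`exists_runsIn_toProg`). Stack programs are compiled to machines step by step (`Runs.iterate_step`,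
`decidableInPolyTime_of_runs`). -/

namespace StackProg

/-! ### Structured stack programs and their compilation to multi-stack machines -/

/-- Structured programs over a family of stacks of bits. -/
inductive Prog (K : Type) : Type
  | skip : Prog K
  | push (k : K) (b : Bool) : Prog K
  | seq (p q : Prog K) : Prog K
  /-- Pop the stack `k` and continue with one of three programs according to the popped bit. -/
  | case (k : K) (p₀ p₁ p₂ : Prog K) : Prog K
  /-- Pop the stack `k` and repeat the body as long as the popped bit is `true`. -/
  | loop (k : K) (p : Prog K) : Prog K

variable {K : Type}

namespace Prog

/-- The labels of the machine that runs a program. -/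
def Lab : Prog K → Type
  | skip => Unit
  | push _ _ => Unit
  | seq p q => Lab p ⊕ Lab q
  | case _ p q r => Option (Lab p ⊕ (Lab q ⊕ Lab r))
  | loop _ p => Option (Lab p)

/-- The label at which the execution of a program begins. -/
def entry : (p : Prog K) → Lab p
  | skip => ()
  | push _ _ => ()
  | seq p _ => Sum.inl (entry p)
  | case _ _ _ _ => none
  | loop _ _ => none

theorem finite_lab (p : Prog K) : Finite (Lab p) := by
  induction p with
  | skip => exact inferInstanceAs (Finite Unit)
  | push => exact inferInstanceAs (Finite Unit)
  | seq p q hp hq => exact inferInstanceAs (Finite (Lab p ⊕ Lab q))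
  | case k p q r hp hq hr => exact inferInstanceAs (Finite (Option (Lab p ⊕ (Lab q ⊕ Lab r))))
  | loop k p hp => exact inferInstanceAs (Finite (Option (Lab p)))

open Turing.TM2.Stmt in
/-- Pop the stack `k` and jump to one of three labels according to the popped bit. -/
def popThen {Λ : Type} (k : K) (l₀ l₁ l₂ : Λ) :
    Turing.TM2.Stmt (fun _ : K => Bool) Λ (Option Bool) :=
  pop k (fun _ o => o) <|
    branch (fun v => v == none) (load (fun _ => none) (goto fun _ => l₀)) <|
    branch (fun v => v == some true) (load (fun _ => none) (goto fun _ => l₁))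
      (load (fun _ => none) (goto fun _ => l₂))

open Turing.TM2.Stmt in
/-- The statements of the machine that runs a program. The internal state is `none` between any
two steps. -/
def code : (p : Prog K) → {Λ : Type} → (Lab p → Λ) → Λ → Lab p →
    Turing.TM2.Stmt (fun _ : K => Bool) Λ (Option Bool)
  | skip, _, _, out, _ => goto fun _ => out
  | push k b, _, _, out, _ => Turing.TM2.Stmt.push k (fun _ => b) (goto fun _ => out)
  | seq p q, _, e, out, l =>
    match l with
    | Sum.inl l => code p (e ∘ Sum.inl) (e (Sum.inr (entry q))) l
    | Sum.inr l => code q (e ∘ Sum.inr) out l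
  | case k p q r, _, e, out, l =>
    match l with
    | none => popThen k (e (some (Sum.inl (entry p)))) (e (some (Sum.inr (Sum.inl (entry q)))))
        (e (some (Sum.inr (Sum.inr (entry r)))))
    | some (Sum.inl l) => code p (e ∘ some ∘ Sum.inl) out l
    | some (Sum.inr (Sum.inl l)) => code q (e ∘ some ∘ Sum.inr ∘ Sum.inl) out l
    | some (Sum.inr (Sum.inr l)) => code r (e ∘ some ∘ Sum.inr ∘ Sum.inr) out l
  | loop k p, _, e, out, l =>
    match l with
    | none => popThen k out (e (some (entry p))) out
    | some l => code p (e ∘ some) (e none) l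

end Prog

open Prog Function

variable [DecidableEq K]

/-- `Runs p S S' t`: the program `p` transforms the stacks `S` into `S'` in `t` steps. -/
inductive Runs : Prog K → (K → List Bool) → (K → List Bool) → ℕ → Prop
  | skip (S) : Runs skip S S 1
  | push (k b S) : Runs (push k b) S (update S k (b :: S k)) 1
  | seq {p q S S' S'' t t'} : Runs p S S' t → Runs q S' S'' t' → Runs (seq p q) S S'' (t' + t)
  | case_nil {k p q r S S' t} : S k = [] → Runs p S S' t → Runs (case k p q r) S S' (t + 1)
  | case_true {k p q r S S' t l} : S k = true :: l → Runs q (update S k l) S' t →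
      Runs (case k p q r) S S' (t + 1)
  | case_false {k p q r S S' t l} : S k = false :: l → Runs r (update S k l) S' t →
      Runs (case k p q r) S S' (t + 1)
  | loop_nil {k p S} : S k = [] → Runs (loop k p) S S 1
  | loop_false {k p S l} : S k = false :: l → Runs (loop k p) S (update S k l) 1
  | loop_true {k p S S' S'' t t' l} : S k = true :: l → Runs p (update S k l) S' t →
      Runs (loop k p) S' S'' t' → Runs (loop k p) S S'' (t' + t + 1)

section Step

variable {Λ : Type} {k : K} {l₀ l₁ l₂ : Λ} {S : K → List Bool} {l : List Bool}

theorem stepAux_popThen_nil (h : S k = []) :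
    Turing.TM2.stepAux (popThen k l₀ l₁ l₂) none S = ⟨some l₀, none, S⟩ := by
  have : update S k [] = S := by rw [← h, update_eq_self]
  simp [popThen, h, this]

theorem stepAux_popThen_true (h : S k = true :: l) :
    Turing.TM2.stepAux (popThen k l₀ l₁ l₂) none S = ⟨some l₁, none, update S k l⟩ := by
  simp [popThen, h]

theorem stepAux_popThen_false (h : S k = false :: l) :
    Turing.TM2.stepAux (popThen k l₀ l₁ l₂) none S = ⟨some l₂, none, update S k l⟩ := by
  simp [popThen, h]

theorem iterate_succ_step {m : Λ → Turing.TM2.Stmt (fun _ : K => Bool) Λ (Option Bool)} {l : Λ}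
    {q : Turing.TM2.Stmt (fun _ : K => Bool) Λ (Option Bool)} (h : m l = q) (t : ℕ)
    {v : Option Bool} {c : Turing.TM2.Cfg (fun _ : K => Bool) Λ (Option Bool)}
    (hc : Turing.TM2.stepAux q v S = c) :
    (flip bind (Turing.TM2.step m))^[t + 1] (some ⟨some l, v, S⟩) =
      (flip bind (Turing.TM2.step m))^[t] (some c) := by
  rw [iterate_succ_apply, ← hc, ← h]
  rfl

end Step

/-- The embedding `e` of labels and the exit label `out` are arbitrary, so that the induction
hypothesis applies to a subprogram sitting inside a larger machine. The times are added as `t' + t`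
to match the composition of iterates, in which the first run is innermost. -/
theorem Runs.iterate_step {p : Prog K} {S S' : K → List Bool} {t : ℕ} (h : Runs p S S' t) :
    ∀ {Λ : Type} (e : Lab p → Λ) (out : Λ)
      (m : Λ → Turing.TM2.Stmt (fun _ : K => Bool) Λ (Option Bool)),
      (∀ l, m (e l) = code p e out l) →
      (flip bind (Turing.TM2.step m))^[t] (some ⟨some (e (entry p)), none, S⟩) =
        some ⟨some out, none, S'⟩ := by
  induction h with
  | skip S => exact fun e out m hm => iterate_succ_step (hm ()) 0 rfl
  | push k b S => exact fun e out m hm => iterate_succ_step (hm ()) 0 rfl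
  | seq _ _ ih₁ ih₂ =>
    intro Λ e out m hm
    rw [iterate_add_apply]
    exact (congrArg _ (ih₁ (e ∘ Sum.inl) _ m fun l => hm (Sum.inl l))).trans
      (ih₂ (e ∘ Sum.inr) out m fun l => hm (Sum.inr l))
  | case_nil hS _ ih =>
    exact fun e out m hm => (iterate_succ_step (hm none) _ (stepAux_popThen_nil hS)).trans
      (ih (e ∘ some ∘ Sum.inl) out m fun l => hm (some (Sum.inl l)))
  | case_true hS _ ih =>
    exact fun e out m hm => (iterate_succ_step (hm none) _ (stepAux_popThen_true hS)).trans
      (ih (e ∘ some ∘ Sum.inr ∘ Sum.inl) out m fun l => hm (some (Sum.inr (Sum.inl l))))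
  | case_false hS _ ih =>
    exact fun e out m hm => (iterate_succ_step (hm none) _ (stepAux_popThen_false hS)).trans
      (ih (e ∘ some ∘ Sum.inr ∘ Sum.inr) out m fun l => hm (some (Sum.inr (Sum.inr l))))
  | loop_nil hS =>
    exact fun e out m hm => iterate_succ_step (hm none) 0 (stepAux_popThen_nil hS)
  | loop_false hS =>
    exact fun e out m hm => iterate_succ_step (hm none) 0 (stepAux_popThen_false hS)
  | loop_true hS _ _ ih₁ ih₂ =>
    intro Λ e out m hm
    refine (iterate_succ_step (hm none) _ (stepAux_popThen_true hS)).trans ?_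
    rw [iterate_add_apply]
    exact (congrArg _ (ih₁ (e ∘ some) _ m fun l => hm (some l))).trans (ih₂ e out m hm)

/-- A step pushes at most one bit. This bounds the contents left on the stacks, and hence the cost
of the final clean-up. -/
theorem Runs.length_le {p : Prog K} {S S' : K → List Bool} {t : ℕ} (h : Runs p S S' t) (k : K) :
    (S' k).length ≤ (S k).length + t := by
  induction h with
  | skip S => simp
  | push k' b S =>
    by_cases hk : k = k' <;> simp [hk]
  | seq _ _ ih₁ ih₂ => omega
  | case_nil _ _ ih => omega
  | @case_true k' _ _ _ S _ _ l hS _ ih | @case_false k' _ _ _ S _ _ l hS _ ih =>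
    by_cases hk : k = k'
    · subst hk; simp [hS] at ih ⊢; omega
    · simp [hk] at ih; omega
  | loop_nil => simp
  | @loop_false k' _ S l hS =>
    by_cases hk : k = k'
    · subst hk; simp [hS]; omega
    · simp [hk]
  | @loop_true k' _ S _ _ _ _ l hS _ _ ih₁ ih₂ =>
    by_cases hk : k = k'
    · subst hk; simp [hS] at ih₁ ⊢; omega
    · simp [hk] at ih₁; omega

/-- The machine that runs a program. -/
noncomputable def machine [Fintype K] (p : Prog K) (k₀ k₁ : K) : Turing.FinTM2 :=
  letI := finite_lab p
  letI : Fintype (Lab p) := Fintype.ofFinite _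
  { K := K
    k₀ := k₀
    k₁ := k₁
    Γ := fun _ => Bool
    Λ := Option (Lab p)
    main := some (entry p)
    σ := Option Bool
    initialState := none
    Γk₀Fin := inferInstanceAs (Fintype Bool)
    m := fun l => l.elim Turing.TM2.Stmt.halt (code p some none) }

theorem initList_machine [Fintype K] (p : Prog K) (k₀ k₁ : K) (s : List Bool) :
    Turing.initList (machine p k₀ k₁) s = ⟨some (some (entry p)), none, update (fun _ => []) k₀ s⟩ := by
  unfold Turing.initList
  congr 1
  funext (k : K)
  by_cases hk : k = k₀
  · subst hk
    exact (dif_pos rfl).trans (update_self (β := fun _ : K => List Bool) k s _).symm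
  · exact (dif_neg hk).trans (update_of_ne (β := fun _ : K => List Bool) hk s fun _ => []).symm

theorem haltList_machine [Fintype K] (p : Prog K) (k₀ k₁ : K) (s : List Bool) :
    Turing.haltList (machine p k₀ k₁) s = ⟨none, none, update (fun _ => []) k₁ s⟩ := by
  unfold Turing.haltList
  congr 1
  funext (k : K)
  by_cases hk : k = k₁
  · subst hk
    exact (dif_pos rfl).trans (update_self (β := fun _ : K => List Bool) k s _).symm
  · exact (dif_neg hk).trans (update_of_ne (β := fun _ : K => List Bool) hk s fun _ => []).symm

/-- A program that computes the answer to a decision problem in polynomial time yields a machine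
that does so. -/
theorem decidableInPolyTime_of_runs [Fintype K] {β : Type} (enc : β → List Bool) (P : β → Prop)
    [DecidablePred P] (p : Prog K) (k₀ k₁ : K) (T : Polynomial ℕ)
    (h : ∀ b, ∃ t ≤ T.eval (enc b).length,
      Runs p (update (fun _ => []) k₀ (enc b)) (update (fun _ => []) k₁ [decide (P b)]) t) :
    SDI.DecidableInPolyTime enc P := by
  refine ⟨fun b => decide (P b), fun b => decide_eq_true_iff, ⟨?_⟩⟩
  refine
    { tm := machine p k₀ k₁
      inputAlphabet := Equiv.refl Bool
      outputAlphabet := Equiv.refl Bool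
      time := T + 1
      outputsFun := fun b =>
        { steps := (h b).choose + 1
          evals_in_steps := ?_
          steps_le_m := by
            have := (h b).choose_spec.1
            simp only [Polynomial.eval_add, Polynomial.eval_one]
            omega } }
  have hr := (h b).choose_spec.2
  set t := (h b).choose
  have := hr.iterate_step (e := some) none
    (fun l => l.elim Turing.TM2.Stmt.halt (code p some none)) (fun _ => rfl)
  have h₀ : Turing.initList (machine p k₀ k₁) (List.map (Equiv.refl Bool).invFun (enc b)) = _ :=
    (congrArg (Turing.initList (machine p k₀ k₁)) (List.map_id (enc b))).trans
      (initList_machine p k₀ k₁ (enc b))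
  -- The additional step executes `halt` at the exit label `none`.
  rw [add_comm, iterate_add_apply]
  refine (congrArg _ (congrArg _ (congrArg some h₀))).trans ?_
  exact (congrArg _ this).trans (congrArg some (haltList_machine p k₀ k₁ [decide (P b)]).symm)


/-! ### Runs with time bounds, and arithmetic on unary counters -/

open Prog Function

section Generic

variable {K : Type} [DecidableEq K] {p q r : Prog K} {S S' S'' : K → List Bool} {a b : ℕ}

/-- The program `p` transforms the stacks `S` into `S'` in at most `T` steps. -/
def RunsIn (p : Prog K) (S S' : K → List Bool) (T : ℕ) : Prop := ∃ t ≤ T, Runs p S S' t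

theorem RunsIn.mono (h : RunsIn p S S' a) (hab : a ≤ b) : RunsIn p S S' b :=
  let ⟨t, ht, hr⟩ := h
  ⟨t, ht.trans hab, hr⟩

theorem RunsIn.of_eq (h : RunsIn p S S' a) (hS : S' = S'') (hab : a ≤ b) : RunsIn p S S'' b :=
  hS ▸ h.mono hab

theorem RunsIn.skip (S : K → List Bool) : RunsIn skip S S 1 := ⟨1, le_rfl, .skip S⟩

theorem RunsIn.push (k : K) (b : Bool) (S : K → List Bool) :
    RunsIn (push k b) S (update S k (b :: S k)) 1 := ⟨1, le_rfl, .push k b S⟩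

theorem RunsIn.seq (h₁ : RunsIn p S S' a) (h₂ : RunsIn q S' S'' b) :
    RunsIn (seq p q) S S'' (a + b) := by
  obtain ⟨t, ht, h₁⟩ := h₁
  obtain ⟨t', ht', h₂⟩ := h₂
  exact ⟨t' + t, by omega, .seq h₁ h₂⟩

theorem RunsIn.case_nil {k : K} (hS : S k = []) (h : RunsIn p S S' a) :
    RunsIn (case k p q r) S S' (a + 1) := by
  obtain ⟨t, ht, h⟩ := h
  exact ⟨t + 1, by omega, .case_nil hS h⟩

theorem RunsIn.case_true {k : K} {l : List Bool} (hS : S k = true :: l)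
    (h : RunsIn q (update S k l) S' a) : RunsIn (case k p q r) S S' (a + 1) := by
  obtain ⟨t, ht, h⟩ := h
  exact ⟨t + 1, by omega, .case_true hS h⟩

theorem RunsIn.case_false {k : K} {l : List Bool} (hS : S k = false :: l)
    (h : RunsIn r (update S k l) S' a) : RunsIn (case k p q r) S S' (a + 1) := by
  obtain ⟨t, ht, h⟩ := h
  exact ⟨t + 1, by omega, .case_false hS h⟩

theorem RunsIn.loop_nil {k : K} (hS : S k = []) : RunsIn (loop k p) S S 1 :=
  ⟨1, le_rfl, .loop_nil hS⟩

theorem RunsIn.loop_true {k : K} {l : List Bool} (hS : S k = true :: l)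
    (h₁ : RunsIn p (update S k l) S' a) (h₂ : RunsIn (loop k p) S' S'' b) :
    RunsIn (loop k p) S S'' (a + b + 1) := by
  obtain ⟨t, ht, h₁⟩ := h₁
  obtain ⟨t', ht', h₂⟩ := h₂
  exact ⟨t' + t + 1, by omega, .loop_true hS h₁ h₂⟩

/-- Unary notation of a natural number. -/
def unary (n : ℕ) : List Bool := List.replicate n true

@[simp] theorem unary_zero : unary 0 = [] := rfl

theorem unary_succ (n : ℕ) : unary (n + 1) = true :: unary n := rfl

theorem unary_append_cons (n : ℕ) (l : List Bool) :
    unary n ++ true :: l = unary (n + 1) ++ l := by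
  simp [unary, List.replicate_succ']

theorem unary_append (m n : ℕ) : unary m ++ unary n = unary (m + n) := by
  simp [unary, List.replicate_append_replicate]

/-- Move a counter. -/
def move (a b : K) : Prog K := loop a (push b true)

/-- The loop ends by popping the first bit of `l`, if there is one, whence `l.tail`. With `l = []`
this moves a counter; with `l` beginning with `false` it reads a self-delimiting number from the
input and consumes the delimiter. -/
theorem runsIn_move {a b : K} (hab : a ≠ b) {l : List Bool} (hl : ∀ l', l ≠ true :: l') (n : ℕ) :
    ∀ S : K → List Bool, S a = unary n ++ l →
      RunsIn (move a b) S (update (update S a l.tail) b (unary n ++ S b)) (2 * n + 1) := by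
  induction n with
  | zero =>
    intro S hS
    match l, hl with
    | [], _ =>
      refine (RunsIn.loop_nil hS).of_eq ?_ (by simp)
      funext z
      simp only [update_apply]
      split_ifs <;> simp_all
    | false :: l, _ =>
      exact RunsIn.of_eq ⟨1, le_rfl, Runs.loop_false hS⟩ (by simp [hab.symm]) (by simp)
    | true :: l, hl => exact absurd rfl (hl l)
  | succ n ih =>
    intro S hS
    refine (RunsIn.loop_true (l := unary n ++ l) hS (RunsIn.push _ _ _) (ih _ (by simp [hab]))).of_eq ?_ (by omega)
    funext z
    by_cases h₁ : z = b
    · subst h₁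
      simp [hab.symm, unary_append_cons]
    · by_cases h₂ : z = a
      · subst h₂; simp [h₁]
      · simp [h₁, h₂]

theorem runsIn_move_unary {a b : K} (hab : a ≠ b) {n : ℕ} (h : S a = unary n) :
    RunsIn (move a b) S (update (update S a []) b (unary n ++ S b)) (2 * n + 1) :=
  runsIn_move hab (l := []) (by simp) n S (by simpa using h)

/-- Move a counter to two places. -/
def moveTwo (a b c : K) : Prog K := loop a (seq (push b true) (push c true))

theorem runsIn_moveTwo {a b c : K} (hab : a ≠ b) (hac : a ≠ c) (hbc : b ≠ c) (n : ℕ) :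
    ∀ S : K → List Bool, S a = unary n →
      RunsIn (moveTwo a b c) S
        (update (update (update S a []) b (unary n ++ S b)) c (unary n ++ S c)) (3 * n + 1) := by
  induction n with
  | zero =>
    intro S hS
    refine (RunsIn.loop_nil hS).of_eq ?_ (by simp)
    funext z
    simp only [update_apply]
    split_ifs <;> simp_all
  | succ n ih =>
    intro S hS
    refine (RunsIn.loop_true (l := unary n) hS ((RunsIn.push _ _ _).seq (RunsIn.push _ _ _))
      (ih _ (by simp [hab, hac]))).of_eq ?_ (by omega)
    funext z
    by_cases h₁ : z = c
    · subst h₁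
      simp [hac.symm, hbc.symm, unary_append_cons]
    · by_cases h₂ : z = b
      · subst h₂; simp [h₁, hab.symm, unary_append_cons]
      · by_cases h₃ : z = a
        · subst h₃; simp [h₁, h₂]
        · simp [h₁, h₂, h₃]

/-- Add the counter `a` to `b`, using the empty stack `t`. -/
def add (a b t : K) : Prog K := seq (move a t) (moveTwo t a b)

theorem runsIn_add {a b t : K} (hab : a ≠ b) (hat : a ≠ t) (hbt : b ≠ t) {n : ℕ}
    (ha : S a = unary n) (ht : S t = []) :
    RunsIn (add a b t) S (update S b (unary n ++ S b)) (5 * n + 2) := by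
  refine ((runsIn_move_unary hat ha).seq (runsIn_moveTwo hat.symm hbt.symm hab n _
    (by simp [ht]))).of_eq ?_ (by omega)
  funext z
  by_cases h₁ : z = b
  · subst h₁; simp [hbt, hab.symm]
  · by_cases h₂ : z = a
    · subst h₂; simp [h₁, hat, ha]
    · by_cases h₃ : z = t
      · subst h₃; simp [h₁, h₂, ht]
      · simp [h₁, h₂, h₃]

end Generic

/-! ### The concrete stacks, and the evaluation of polynomial addresses -/

/-- The stacks of the machine: input, output, six tables, variables, loop counters and scratch
space. -/
inductive Stack : Type
  | inp | out | acc | aux | tmp | addr | cnt | buf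
  | mem (i : Fin 6)
  | var (x : Fin 10)
  | rem (x : Fin 10)
  deriving DecidableEq, Fintype

open Stack

variable {S : Stack → List Bool}

/-- Multiply the accumulator with a variable. -/
def mulAcc (x : Fin 10) : Prog Stack := seq (move acc aux) (loop aux (add (var x) acc tmp))

theorem runsIn_mulAcc_loop {x : Fin 10} {n : ℕ} (r : ℕ) : ∀ S : Stack → List Bool,
    S (var x) = unary n → S tmp = [] → S aux = unary r → ∀ a, S acc = unary a →
    RunsIn (loop aux (add (var x) acc tmp)) S
      (update (update S aux []) acc (unary (r * n + a))) (r * (5 * n + 3) + 1) := by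
  induction r with
  | zero =>
    intro S _ _ hS a ha
    refine (RunsIn.loop_nil hS).of_eq ?_ (by simp)
    funext z
    simp only [update_apply]
    split_ifs <;> simp_all
  | succ r ih =>
    intro S hx ht hr a ha
    refine (RunsIn.loop_true (l := unary r) hr (runsIn_add (n := n) (by simp) (by simp) (by simp) (by simp [hx])
      (by simp [ht])) (ih _ (by simp [hx]) (by simp [ht]) (by simp) (n + a)
      (by simp [ha, unary_append]))).of_eq ?_ (by ring_nf; omega)
    funext z
    by_cases h₁ : z = acc
    · subst h₁
      simp only [update_self]
      congr 1
      ring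
    · by_cases h₂ : z = aux
      · subst h₂; simp
      · simp [h₁, h₂]

theorem runsIn_mulAcc {x : Fin 10} {n r : ℕ} (hx : S (var x) = unary n) (ht : S tmp = [])
    (ha : S aux = []) (hr : S acc = unary r) :
    RunsIn (mulAcc x) S (update S acc (unary (r * n))) (r * (5 * n + 5) + 2) := by
  refine ((runsIn_move_unary (by simp) hr).seq (runsIn_mulAcc_loop (n := n) r _ (by simp [hx])
    (by simp [ht]) (by simp [ha]) 0 (by simp))).of_eq ?_ (by ring_nf; omega)
  funext z
  by_cases h₁ : z = acc
  · subst h₁; simp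
  · by_cases h₂ : z = aux
    · subst h₂; simp [ha]
    · simp [h₁, h₂]

/-- Multiply the accumulator with a product of variables. -/
def mulMonomial : List (Fin 10) → Prog Stack
  | [] => skip
  | x :: l => seq (mulAcc x) (mulMonomial l)

/-- The cost of a multiplication depends on the accumulator, so its bound `Q` is part of the
induction: each factor, being at most `N`, replaces `Q` by `Q * X`. -/
theorem exists_runsIn_mulMonomial (l : List (Fin 10)) : ∀ Q : Polynomial ℕ, ∃ P : Polynomial ℕ,
    ∀ (N : ℕ) (ρ : Fin 10 → ℕ) (r : ℕ) (S : Stack → List Bool), (∀ x, ρ x ≤ N) → r ≤ Q.eval N →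
      (∀ x, S (var x) = unary (ρ x)) → S tmp = [] → S aux = [] → S acc = unary r →
      RunsIn (mulMonomial l) S (update S acc (unary (r * (l.map ρ).prod))) (P.eval N) := by
  induction l with
  | nil =>
    refine fun Q => ⟨1, fun N ρ r S _ _ _ _ _ ha => (RunsIn.skip _).of_eq ?_ (by simp)⟩
    simp [← ha]
  | cons x l ih =>
    intro Q
    obtain ⟨P, hP⟩ := ih (Q * Polynomial.X)
    refine ⟨Q * (5 * Polynomial.X + 5) + 2 + P, fun N ρ r S hρ hr hx ht ha hacc =>
      ((runsIn_mulAcc (hx x) ht ha hacc).seq (hP N ρ (r * ρ x) _ hρ ?_ ?_ ?_ ?_ ?_)).of_eq ?_ ?_⟩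
    · simpa using Nat.mul_le_mul hr (hρ x)
    · simp [hx]
    · simp [ht]
    · simp [ha]
    · simp
    · simp [mul_assoc]
    · have h₁ := hρ x
      simp only [Polynomial.eval_add, Polynomial.eval_mul, Polynomial.eval_ofNat, Polynomial.eval_X]
      gcongr

/-- Polynomial expressions, as sums of products of variables. -/
abbrev Expr := List (List (Fin 10))

/-- The value of an expression. -/
def Expr.val (ρ : Fin 10 → ℕ) (e : Expr) : ℕ := (e.map fun l => (l.map ρ).prod).sum

/-- Add the value of an expression to the address register. -/
def computeExpr : Expr → Prog Stack
  | [] => skip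
  | l :: e => seq (push acc true) (seq (mulMonomial l) (seq (move acc addr) (computeExpr e)))

theorem exists_val_le (e : Expr) : ∃ P : Polynomial ℕ, ∀ (N : ℕ) (ρ : Fin 10 → ℕ),
    (∀ x, ρ x ≤ N) → Expr.val ρ e ≤ P.eval N := by
  induction e with
  | nil => exact ⟨0, fun N ρ _ => by simp [Expr.val]⟩
  | cons l e ih =>
    obtain ⟨P, hP⟩ := ih
    refine ⟨Polynomial.X ^ l.length + P, fun N ρ hρ => ?_⟩
    have h : (l.map ρ).prod ≤ N ^ l.length := by
      simpa using List.prod_le_pow_card (l.map ρ) N (by simpa using fun x _ => hρ x)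
    have h' := hP N ρ hρ
    simp only [Expr.val] at h'
    simpa [Expr.val] using Nat.add_le_add h h'

theorem exists_runsIn_computeExpr (e : Expr) : ∃ P : Polynomial ℕ,
    ∀ (N : ℕ) (ρ : Fin 10 → ℕ) (a : ℕ) (S : Stack → List Bool), (∀ x, ρ x ≤ N) →
      (∀ x, S (var x) = unary (ρ x)) → S tmp = [] → S aux = [] → S acc = [] → S addr = unary a →
      RunsIn (computeExpr e) S (update S addr (unary (Expr.val ρ e + a))) (P.eval N) := by
  induction e with
  | nil =>
    refine ⟨1, fun N ρ a S _ _ _ _ _ ha => (RunsIn.skip _).of_eq ?_ (by simp)⟩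
    simp [Expr.val, ← ha]
  | cons l e ih =>
    obtain ⟨P, hP⟩ := ih
    obtain ⟨Q, hQ⟩ := exists_runsIn_mulMonomial l 1
    obtain ⟨V, hV⟩ := exists_val_le [l]
    -- `V` bounds the monomial, and so the cost of moving it from the accumulator to the address
    -- register.
    refine ⟨1 + (Q + ((2 * V + 1) + P)), fun N ρ a S hρ hx ht ha hacc haddr => ?_⟩
    have hV' : (l.map ρ).prod ≤ V.eval N := by simpa [Expr.val] using hV N ρ hρ
    refine ((RunsIn.push acc true S).seq ((hQ N ρ 1 _ hρ (by simp) (by simp [hx]) (by simp [ht])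
      (by simp [ha]) (by simp [hacc, unary])).seq ((runsIn_move_unary (n := (l.map ρ).prod) (by simp)
        (by simp)).seq (hP N ρ ((l.map ρ).prod + a) _ hρ (by simp [hx]) (by simp [ht])
        (by simp [ha]) (by simp) (by simp [haddr, unary_append]))))).of_eq ?_ ?_
    · funext z
      by_cases h₁ : z = addr
      · subst h₁; simp [Expr.val]; congr 1; ring
      · by_cases h₂ : z = acc
        · subst h₂; simp [hacc]
        · simp [h₁, h₂]
    · simp only [Polynomial.eval_add, Polynomial.eval_mul, Polynomial.eval_ofNat,
        Polynomial.eval_one]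
      gcongr

/-! ### Random access to tables held on stacks -/

/-- The tables that a program may read: the input and the six memory tables. -/
def tableStack : Option (Fin 6) → Stack
  | none => inp
  | some i => mem i

section Tables

variable (τ : Option (Fin 6))

@[simp] theorem tableStack_ne : tableStack τ ≠ addr ∧ tableStack τ ≠ cnt ∧ tableStack τ ≠ buf ∧
    addr ≠ tableStack τ ∧ cnt ≠ tableStack τ ∧ buf ≠ tableStack τ := by
  cases τ <;> simp [tableStack]

/-- The first `i` entries of a table, padded with zeros if required. -/
def grab (pad : Bool) (i : ℕ) (l : List Bool) : List Bool :=
  if pad then l.takeD i false else l.take i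

/-- Move as many entries of a table as the address register says to the buffer. -/
def fetch (pad : Bool) : Prog Stack :=
  loop addr (seq (push cnt true)
    (case (tableStack τ) (if pad then push buf false else skip) (push buf true) (push buf false)))

/-- The counter `cnt` receives all `i` units even if the table is shorter. Without padding the
buffer may then hold fewer than `i` bits, a case that `runsIn_restore` permits. -/
theorem runsIn_fetch (pad : Bool) (i : ℕ) : ∀ (S : Stack → List Bool) (l b : List Bool) (c : ℕ),
    S addr = unary i → S (tableStack τ) = l → S buf = b → S cnt = unary c →
    RunsIn (fetch τ pad) S (update (update (update (update S addr []) (tableStack τ) (l.drop i))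
      buf ((grab pad i l).reverse ++ b)) cnt (unary (i + c))) (4 * i + 1) := by
  obtain ⟨h₁, h₂, h₃, h₄, h₅, h₆⟩ := tableStack_ne τ
  induction i with
  | zero =>
    intro S l b c ha hl hb hc
    refine (RunsIn.loop_nil ha).of_eq ?_ (by simp)
    funext z
    simp only [update_apply]
    split_ifs <;> subst_vars <;> cases pad <;> simp [grab, ha, hc]
  | succ i ih =>
    intro S l b c ha hl hb hc
    rcases l with _ | ⟨_ | _, l⟩
    · cases pad
      · refine (RunsIn.loop_true (l := unary i) ha ((RunsIn.push _ _ _).seq (RunsIn.case_nil (by simp [h₁, h₂, hl])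
          (RunsIn.skip _))) (ih _ [] b (c + 1) (by simp) (by simp [h₁, h₂, hl]) (by simp [hb])
          (by simp [hc, unary_succ]))).of_eq ?_ (by omega)
        funext z
        simp only [update_apply]
        split_ifs <;> simp [grab, Nat.add_assoc, Nat.add_comm c 1]
      · refine (RunsIn.loop_true (l := unary i) ha ((RunsIn.push _ _ _).seq (RunsIn.case_nil (by simp [h₁, h₂, hl])
          (RunsIn.push _ _ _))) (ih _ [] (false :: b) (c + 1) (by simp) (by simp [h₁, h₂, h₃, hl])
          (by simp [hb]) (by simp [hc, unary_succ]))).of_eq ?_ (by omega)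
        funext z
        simp only [update_apply]
        split_ifs <;> simp [grab, Nat.add_assoc, Nat.add_comm c 1]
    · refine (RunsIn.loop_true (l := unary i) ha ((RunsIn.push _ _ _).seq (RunsIn.case_false (l := l)
        (by simp [h₁, h₂, hl]) (RunsIn.push _ _ _))) (ih _ l (false :: b) (c + 1) (by simp [h₄])
        (by simp [h₃]) (by simp [hb, h₆]) (by simp [hc, h₅, unary_succ]))).of_eq ?_ (by omega)
      funext z
      simp only [update_apply]
      split_ifs <;> cases pad <;> simp [grab, Nat.add_assoc, Nat.add_comm c 1]
    · refine (RunsIn.loop_true (l := unary i) ha ((RunsIn.push _ _ _).seq (RunsIn.case_true (l := l)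
        (by simp [h₁, h₂, hl]) (RunsIn.push _ _ _))) (ih _ l (true :: b) (c + 1) (by simp [h₄])
        (by simp [h₃]) (by simp [hb, h₆]) (by simp [hc, h₅, unary_succ]))).of_eq ?_ (by omega)
      funext z
      simp only [update_apply]
      split_ifs <;> cases pad <;> simp [grab, Nat.add_assoc, Nat.add_comm c 1]

/-- Move the buffer back to a table. -/
def restore : Prog Stack :=
  loop cnt (case buf skip (push (tableStack τ) true) (push (tableStack τ) false))

theorem runsIn_restore (i : ℕ) : ∀ (S : Stack → List Bool) (b : List Bool),
    S cnt = unary i → S buf = b → b.length ≤ i →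
    RunsIn (restore τ) S (update (update (update S cnt []) buf []) (tableStack τ)
      (b.reverse ++ S (tableStack τ))) (3 * i + 1) := by
  obtain ⟨h₁, h₂, h₃, h₄, h₅, h₆⟩ := tableStack_ne τ
  induction i with
  | zero =>
    intro S b hc hb hl
    obtain rfl : b = [] := by simpa using hl
    refine (RunsIn.loop_nil hc).of_eq ?_ (by simp)
    funext z
    simp only [update_apply]
    split_ifs <;> subst_vars <;> simp [hb, hc]
  | succ i ih =>
    intro S b hc hb hl
    rcases b with _ | ⟨_ | _, b⟩
    · refine (RunsIn.loop_true (l := unary i) hc (RunsIn.case_nil (by simp [hb]) (RunsIn.skip _))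
        (ih _ [] (by simp) (by simp [hb]) (by simp))).of_eq ?_ (by omega)
      funext z
      simp only [update_apply]
      split_ifs <;> simp_all
    · refine (RunsIn.loop_true (l := unary i) hc (RunsIn.case_false (l := b) (by simp [hb]) (RunsIn.push _ _ _))
        (ih _ b (by simp [h₅]) (by simp [h₆]) (by simpa using hl))).of_eq ?_ (by omega)
      funext z
      simp only [update_apply]
      split_ifs <;> simp_all
    · refine (RunsIn.loop_true (l := unary i) hc (RunsIn.case_true (l := b) (by simp [hb]) (RunsIn.push _ _ _))
        (ih _ b (by simp [h₅]) (by simp [h₆]) (by simpa using hl))).of_eq ?_ (by omega)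
      funext z
      simp only [update_apply]
      split_ifs <;> simp_all

/-- Run `p` if the addressed entry of a table is `true`. -/
def ifBit (p : Prog Stack) : Prog Stack :=
  seq (fetch τ false) (case (tableStack τ) (restore τ) (seq (push (tableStack τ) true)
    (seq (restore τ) p)) (seq (push (tableStack τ) false) (restore τ)))

theorem runsIn_ifBit {p : Prog Stack} {i : ℕ} {S' : Stack → List Bool} {T : ℕ}
    (ha : S addr = unary i) (hb : S buf = []) (hc : S cnt = [])
    (h : if (S (tableStack τ)).getD i false = true then RunsIn p (update S addr []) S' T
      else S' = update S addr []) :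
    RunsIn (ifBit τ p) S S' (7 * i + 4 + T) := by
  obtain ⟨h₁, h₂, h₃, h₄, h₅, h₆⟩ := tableStack_ne τ
  have hf := runsIn_fetch τ false i S _ [] 0 ha rfl hb hc
  set l := S (tableStack τ) with hl
  set S₁ := update (update (update (update S addr []) (tableStack τ) (l.drop i))
      buf ((grab false i l).reverse ++ [])) cnt (unary (i + 0)) with hS₁
  -- In every branch the popped bit, if any, has been pushed back before the table is restored.
  have key : ∀ S₂ : Stack → List Bool, (S₂ = update S₁ (tableStack τ) (l.drop i)) →
      RunsIn (restore τ) S₂ (update S addr []) (3 * i + 1) := by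
    rintro S₂ rfl
    refine (runsIn_restore τ i _ (l.take i).reverse (by simp [hS₁, h₅])
      (by simp [hS₁, h₆, grab]) (by simp)).of_eq ?_ le_rfl
    funext z
    simp only [update_apply, hS₁]
    split_ifs <;> simp_all
  have ht : S₁ (tableStack τ) = l.drop i := by simp [hS₁, h₂, h₃]
  rcases hd : l.drop i with _ | ⟨b, l'⟩
  · have hle : l.length ≤ i := by simpa using hd
    rw [if_neg (by simp [List.getD_eq_getElem?_getD, hle])] at h
    subst h
    exact (hf.seq (RunsIn.case_nil (ht.trans hd) (key _ (by simp [← ht])))).mono (by omega)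
  · have hg : l.getD i false = b := by
      have := congrArg (fun l => l[0]?) hd
      simp at this
      simp [List.getD_eq_getElem?_getD, this]
    rw [hg] at h
    cases b
    · rw [if_neg (by simp)] at h
      subst h
      exact (hf.seq (RunsIn.case_false (ht.trans hd) ((RunsIn.push _ _ _).seq
        (key _ (by simp [hd]))))).mono (by omega)
    · rw [if_pos rfl] at h
      exact (hf.seq (RunsIn.case_true (ht.trans hd) ((RunsIn.push _ _ _).seq
        ((key _ (by simp [hd])).seq h)))).mono (by omega)

/-- Set the addressed entry of a table. -/
def setBit : Prog Stack :=
  seq (fetch τ true) (seq (case (tableStack τ) skip skip skip)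
    (seq (push (tableStack τ) true) (restore τ)))

/-- The table `l` with the `i`-th entry set to `true`. -/
def setTrue (l : List Bool) (i : ℕ) : List Bool := l.takeD i false ++ true :: l.drop (i + 1)

/-- Reading beyond the end gives `false` and writing there pads, so a table is a finite set of
numbers that starts empty and needs no allocation. -/
theorem getD_setTrue (l : List Bool) (i j : ℕ) :
    (setTrue l i).getD j false = true ↔ j = i ∨ l.getD j false = true := by
  induction i generalizing l j with
  | zero => cases l <;> cases j <;> simp [setTrue]
  | succ i ih =>
    cases j with
    | zero => cases l <;> simp [setTrue]
    | succ j =>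
      have := ih l.tail j
      cases l <;> simpa [setTrue] using this

theorem runsIn_setBit {i : ℕ} (ha : S addr = unary i) (hb : S buf = []) (hc : S cnt = []) :
    RunsIn (setBit τ) S (update (update S addr []) (tableStack τ)
      (setTrue (S (tableStack τ)) i)) (7 * i + 6) := by
  obtain ⟨h₁, h₂, h₃, h₄, h₅, h₆⟩ := tableStack_ne τ
  have hf := runsIn_fetch τ true i S _ [] 0 ha rfl hb hc
  set l := S (tableStack τ) with hl
  set S₁ := update (update (update (update S addr []) (tableStack τ) (l.drop i))
      buf ((grab true i l).reverse ++ [])) cnt (unary (i + 0)) with hS₁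
  have ht : S₁ (tableStack τ) = l.drop i := by simp [hS₁, h₂, h₃]
  have hdrop : RunsIn (case (tableStack τ) skip skip skip) S₁
      (update S₁ (tableStack τ) (l.drop (i + 1))) 2 := by
    have htail : l.drop (i + 1) = (l.drop i).tail := by simp
    rw [htail]
    rcases hd : l.drop i with _ | ⟨_ | _, l'⟩
    · exact (RunsIn.case_nil (ht.trans hd) (RunsIn.skip _)).of_eq (by simp [ht.trans hd]) le_rfl
    · exact RunsIn.case_false (ht.trans hd) (RunsIn.skip _)
    · exact RunsIn.case_true (ht.trans hd) (RunsIn.skip _)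
  refine (hf.seq (hdrop.seq ((RunsIn.push _ _ _).seq (runsIn_restore τ i _
    (l.takeD i false).reverse (by simp [hS₁, h₅]) (by simp [hS₁, h₆, grab])
    (by simp))))).of_eq ?_ (by omega)
  funext z
  simp only [update_apply, hS₁]
  split_ifs <;> simp_all [setTrue]

end Tables

/-- Empty a stack. -/
def drain (k : Stack) : Prog Stack :=
  seq (push tmp true) (loop tmp (case k skip (push tmp true) (push tmp true)))

/-- A loop on `k` itself would stop at the first `false`. Instead a flag on `tmp` is renewed
whenever a bit of either value is popped from `k`. -/
theorem runsIn_drain {k : Stack} (hk : k ≠ tmp) (ht : S tmp = []) :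
    RunsIn (drain k) S (update S k []) (3 * (S k).length + 5) := by
  suffices h : ∀ (l : List Bool) (S : Stack → List Bool), S tmp = [true] → S k = l →
      RunsIn (loop tmp (case k skip (push tmp true) (push tmp true))) S
        (update (update S tmp []) k []) (3 * l.length + 4) by
    refine ((RunsIn.push _ _ _).seq (h (S k) _ (by simp [ht]) (by simp [hk]))).of_eq ?_ (by omega)
    funext z
    simp only [update_apply]
    split_ifs <;> simp_all
  intro l
  induction l with
  | nil =>
    intro S hS hl
    refine (RunsIn.loop_true hS (RunsIn.case_nil (by simp [hk, hl]) (RunsIn.skip _))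
      (RunsIn.loop_nil (by simp))).of_eq ?_ (by simp)
    funext z
    simp only [update_apply]
    split_ifs <;> simp_all
  | cons b l ih =>
    intro S hS hl
    have hrun : RunsIn (case k skip (push tmp true) (push tmp true)) (update S tmp [])
        (update (update S tmp [true]) k l) 2 := by
      have he : update (update (update S tmp []) k l) tmp [true] =
          update (update S tmp [true]) k l := by
        funext z
        simp only [update_apply]
        split_ifs <;> simp_all
      cases b
      · exact (RunsIn.case_false (l := l) (by simp [hk, hl]) (RunsIn.push _ _ _)).of_eq
          (by simp [hk.symm, he]) le_rfl
      · exact (RunsIn.case_true (l := l) (by simp [hk, hl]) (RunsIn.push _ _ _)).of_eq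
          (by simp [hk.symm, he]) le_rfl
    refine (RunsIn.loop_true hS hrun (ih _ (by simp [hk.symm]) (by simp))).of_eq ?_
      (by simp; omega)
    funext z
    simp only [update_apply]
    split_ifs <;> simp_all


/-! ### A language of bounded loops and its polynomial-time execution -/

open Function

/-- The stacks that hold the input `w`, the tables `M`, the variables `ρ` and the loop counters
`r`, the scratch space being empty. -/
def store (w : List Bool) (M : Fin 6 → List Bool) (ρ r : Fin 10 → ℕ) : Stack → List Bool
  | .inp => w
  | .mem i => M i
  | .var x => unary (ρ x)
  | .rem x => unary (r x)
  | _ => []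

section Store

variable (w : List Bool) (M : Fin 6 → List Bool) (ρ r : Fin 10 → ℕ)

theorem update_store_var (x : Fin 10) (n : ℕ) :
    update (store w M ρ r) (.var x) (unary n) = store w M (update ρ x n) r := by
  funext z
  cases z <;> simp only [update_apply, store, Stack.var.injEq, reduceCtorEq, if_false]
  split_ifs <;> rfl

theorem update_store_rem (x : Fin 10) (n : ℕ) :
    update (store w M ρ r) (.rem x) (unary n) = store w M ρ (update r x n) := by
  funext z
  cases z <;> simp only [update_apply, store, Stack.rem.injEq, reduceCtorEq, if_false]
  split_ifs <;> rfl

theorem update_store_mem (i : Fin 6) (l : List Bool) :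
    update (store w M ρ r) (.mem i) l = store w (update M i l) ρ r := by
  funext z
  cases z <;> simp only [update_apply, store, Stack.mem.injEq, reduceCtorEq, if_false]

theorem update_store_addr : update (store w M ρ r) .addr [] = store w M ρ r :=
  update_eq_self_iff.2 rfl

end Store

/-- A language of bounded loops. The variables range over natural numbers; the commands can read
the entries of the input and of six tables, and set entries of the tables to `true`. -/
inductive Cmd : Type
  | skip : Cmd
  | seq (c d : Cmd) : Cmd
  | ifBit (τ : Option (Fin 6)) (e : Expr) (c : Cmd) : Cmd
  | set (i : Fin 6) (e : Expr) : Cmd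
  /-- Run `c` for all values of `x` below the value of `y`. -/
  | loop (x y : Fin 10) (c : Cmd) : Cmd

namespace Cmd

/-- A table, or the input. -/
def table (w : List Bool) (M : Fin 6 → List Bool) : Option (Fin 6) → List Bool
  | none => w
  | some i => M i

/-- The tables after the execution of a command. -/
def den (w : List Bool) : Cmd → (Fin 10 → ℕ) → (Fin 6 → List Bool) → Fin 6 → List Bool
  | skip, _, M => M
  | seq c d, ρ, M => den w d ρ (den w c ρ M)
  | ifBit τ e c, ρ, M => if (table w M τ).getD (e.val ρ) false = true then den w c ρ M else M
  | set i e, ρ, M => update M i (setTrue (M i) (e.val ρ))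
  | .loop x y c, ρ, M => (List.range' 0 (ρ y)).foldl (fun M i => den w c (update ρ x i) M) M

/-- The variables bound by a command. -/
def bound : Cmd → Finset (Fin 10)
  | skip => ∅
  | seq c d => bound c ∪ bound d
  | ifBit _ _ c => bound c
  | set _ _ => ∅
  | .loop x _ c => insert x (bound c)

/-- No variable is bound twice in a nested way. -/
def WellFormed : Cmd → Prop
  | skip => True
  | seq c d => WellFormed c ∧ WellFormed d
  | ifBit _ _ c => WellFormed c
  | set _ _ => True
  | .loop x _ c => x ∉ bound c ∧ WellFormed c

/-- The stack program that executes a command. -/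
def toProg : Cmd → Prog Stack
  | skip => Prog.skip
  | seq c d => Prog.seq (toProg c) (toProg d)
  | ifBit τ e c => Prog.seq (computeExpr e) (StackProg.ifBit τ (toProg c))
  | set i e => Prog.seq (computeExpr e) (setBit (some i))
  | .loop x y c =>
    Prog.seq (add (.var y) (.rem x) .tmp) <|
      Prog.seq (Prog.loop (.rem x) (Prog.seq (toProg c) (Prog.push (.var x) true)))
        (drain (.var x))

/-- Induction on the number `j` of rounds left on the loop counter, while the loop variable holds `i
= n - j`. -/
theorem runsIn_loop {w : List Bool} {c : Cmd} {x : Fin 10} {ρ r : Fin 10 → ℕ} {n T : ℕ}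
    (h : ∀ i < n, ∀ j M, RunsIn (toProg c) (store w M (update ρ x i) (update r x j))
      (store w (den w c (update ρ x i) M) (update ρ x i) (update r x j)) T) (j : ℕ) :
    ∀ i M, i + j = n → RunsIn
      (Prog.loop (.rem x) (Prog.seq (toProg c) (Prog.push (.var x) true)))
      (store w M (update ρ x i) (update r x j))
      (store w ((List.range' i j).foldl (fun M i => den w c (update ρ x i) M) M) (update ρ x n)
        (update r x 0)) (j * (T + 2) + 1) := by
  induction j with
  | zero =>
    rintro i M rfl
    exact (RunsIn.loop_nil (by simp [store])).of_eq rfl (by simp)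
  | succ j ih =>
    intro i M hij
    refine (RunsIn.loop_true (l := unary j) (by simp [store, unary_succ])
      (RunsIn.seq (S' := store w (den w c (update ρ x i) M) (update ρ x i) (update r x j)) ?_
        (RunsIn.push _ _ _)) ?_).mono (a := T + 1 + (j * (T + 2) + 1) + 1) (by ring_nf; omega)
    · rw [update_store_rem, update_idem]
      exact h i (by omega) j M
    · have hp : true :: store w (den w c (update ρ x i) M) (update ρ x i) (update r x j)
          (.var x) = unary (i + 1) := by simp [store, unary_succ]
      rw [hp, update_store_var, update_idem]
      exact ih (i + 1) _ (by omega)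

/-- A single `N` bounds all variables throughout, since a loop variable stays below the value of
another variable while the body runs; a loop thus costs at most about `N` times its body. Bound
variables and their counters are zero at the start and are zero again afterwards, so commands
compose; `WellFormed` keeps an inner loop from touching the variable of an outer one. -/
theorem exists_runsIn_toProg (c : Cmd) (hc : c.WellFormed) : ∃ P : Polynomial ℕ,
    ∀ (N : ℕ) (w : List Bool) (M : Fin 6 → List Bool) (ρ r : Fin 10 → ℕ), (∀ x, ρ x ≤ N) →
      (∀ x ∈ c.bound, ρ x = 0 ∧ r x = 0) →
      RunsIn (toProg c) (store w M ρ r) (store w (den w c ρ M) ρ r) (P.eval N) := by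
  induction c with
  | skip => exact ⟨1, fun N w M ρ r _ _ => (RunsIn.skip _).of_eq rfl (by simp)⟩
  | seq c d ihc ihd =>
    obtain ⟨P, hP⟩ := ihc hc.1
    obtain ⟨Q, hQ⟩ := ihd hc.2
    refine ⟨P + Q, fun N w M ρ r hρ hb => ?_⟩
    simp only [bound, Finset.mem_union] at hb
    exact ((hP N w M ρ r hρ fun x hx => hb x (.inl hx)).seq
      (hQ N w _ ρ r hρ fun x hx => hb x (.inr hx))).mono (by simp)
  | ifBit τ e c ih =>
    obtain ⟨P, hP⟩ := ih hc
    obtain ⟨Q, hQ⟩ := exists_runsIn_computeExpr e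
    obtain ⟨V, hV⟩ := exists_val_le e
    refine ⟨Q + (7 * V + 4 + P), fun N w M ρ r hρ hb => ?_⟩
    have he := hQ N ρ 0 (store w M ρ r) hρ (fun x => rfl) rfl rfl rfl rfl
    have hτ : update (store w M ρ r) .addr (unary (e.val ρ + 0)) (tableStack τ) =
        table w M τ := by cases τ <;> rfl
    refine (he.seq (runsIn_ifBit (i := e.val ρ) (T := P.eval N) τ (by simp) rfl rfl ?_)).mono ?_
    · rw [hτ, update_idem, update_store_addr]
      split_ifs with h
      · simpa only [den, if_pos h] using hP N w M ρ r hρ hb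
      · simp only [den, if_neg h]
    · have := hV N ρ hρ
      simp only [Polynomial.eval_add, Polynomial.eval_mul, Polynomial.eval_ofNat]
      omega
  | set i e =>
    obtain ⟨Q, hQ⟩ := exists_runsIn_computeExpr e
    obtain ⟨V, hV⟩ := exists_val_le e
    refine ⟨Q + (7 * V + 6), fun N w M ρ r hρ hb => ?_⟩
    have he := hQ N ρ 0 (store w M ρ r) hρ (fun x => rfl) rfl rfl rfl rfl
    refine (he.seq (runsIn_setBit (i := e.val ρ) (some i) (by simp) rfl rfl)).of_eq ?_ ?_
    · rw [update_idem, update_store_addr]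
      exact update_store_mem ..
    · have := hV N ρ hρ
      simp only [Polynomial.eval_add, Polynomial.eval_mul, Polynomial.eval_ofNat]
      omega
  | loop x y c ih =>
    obtain ⟨P, hP⟩ := ih hc.2
    refine ⟨5 * Polynomial.X + 2 + (Polynomial.X * (P + 2) + 1 + (3 * Polynomial.X + 5)),
      fun N w M ρ r hρ hb => ?_⟩
    obtain ⟨hx₁, hx₂⟩ := hb x (by simp [bound])
    have h₁ := runsIn_add (S := store w M ρ r) (a := .var y) (b := .rem x) (t := .tmp) (by simp)
      (by simp) (by simp) (n := ρ y) rfl rfl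
    have h₂ := runsIn_loop (w := w) (c := c) (x := x) (ρ := ρ) (r := r) (n := ρ y)
      (T := P.eval N) (fun i hi j M => hP N w M _ _ (fun z => ?_) (fun z hz => ?_)) (ρ y) 0 M
      (by simp)
    · have hr : unary (ρ y) ++ store w M ρ r (.rem x) = unary (ρ y) := by simp [store, hx₂]
      have hρ' : update ρ x 0 = ρ := by rw [← hx₁, update_eq_self]
      have hr' : update r x 0 = r := by rw [← hx₂, update_eq_self]
      rw [hr, update_store_rem] at h₁
      rw [hρ', hr'] at h₂
      refine (h₁.seq (h₂.seq (runsIn_drain (by simp) rfl))).of_eq ?_ ?_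
      · rw [← unary_zero, update_store_var, update_idem, hρ']
        rfl
      · have hy := hρ y
        have hl : (store w (List.foldl (fun M i => den w c (update ρ x i) M) M
            (List.range' 0 (ρ y))) (update ρ x (ρ y)) r (.var x)).length = ρ y := by
          simp [store, unary]
        rw [hl]
        simp only [Polynomial.eval_add, Polynomial.eval_mul, Polynomial.eval_ofNat,
          Polynomial.eval_X, Polynomial.eval_one]
        gcongr
    · by_cases hz : z = x
      · subst hz; simpa using hi.le.trans (hρ y)
      · simpa [hz] using hρ z
    · have hz' : z ≠ x := fun h => hc.1 (h ▸ hz)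
      simpa [hz'] using hb z (by simp [bound, hz])

/-! ### Commands as monotone operators, and saturation -/

/-- The set of entries of the tables that are `true`. -/
def bits (M : Fin 6 → List Bool) : Set (Fin 6 × ℕ) := {c | (M c.1).getD c.2 false = true}

/-- The entry `a` of the table `τ` is `true`, when the entries in `Q` of the tables are. -/
def Holds (w : List Bool) (Q : Set (Fin 6 × ℕ)) (a : ℕ) : Option (Fin 6) → Prop
  | none => w.getD a false = true
  | some i => (i, a) ∈ Q

/-- The entries that a command sets, if its tests were evaluated in the tables `Q` throughout. -/
def fires (w : List Bool) : Cmd → (Fin 10 → ℕ) → Set (Fin 6 × ℕ) → Set (Fin 6 × ℕ)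
  | skip, _, _ => ∅
  | seq c d, ρ, Q => fires w c ρ Q ∪ fires w d ρ Q
  | ifBit τ e c, ρ, Q => {z | Holds w Q (e.val ρ) τ ∧ z ∈ fires w c ρ Q}
  | set i e, ρ, _ => {(i, e.val ρ)}
  | .loop x y c, ρ, Q => {z | ∃ i < ρ y, z ∈ fires w c (update ρ x i) Q}

theorem holds_bits (w : List Bool) (M : Fin 6 → List Bool) (a : ℕ) (τ : Option (Fin 6)) :
    Holds w (bits M) a τ ↔ (table w M τ).getD a false = true := by
  cases τ <;> rfl

theorem Holds.mono {w : List Bool} {Q Q' : Set (Fin 6 × ℕ)} (h : Q ⊆ Q') {a : ℕ}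
    {τ : Option (Fin 6)} (hQ : Holds w Q a τ) : Holds w Q' a τ := by
  cases τ with
  | none => exact hQ
  | some i => exact h hQ

theorem bits_set (M : Fin 6 → List Bool) (i : Fin 6) (a : ℕ) :
    bits (update M i (setTrue (M i) a)) = insert (i, a) (bits M) := by
  ext ⟨j, b⟩
  by_cases h : j = i
  · subst h
    simp only [bits, Set.mem_ofPred_eq, update_self, Set.mem_insert_iff, Prod.mk.injEq, true_and]
    exact getD_setTrue _ _ _
  · simp [bits, h]

theorem bits_subset_den (w : List Bool) (c : Cmd) :
    ∀ (ρ : Fin 10 → ℕ) (M : Fin 6 → List Bool), bits M ⊆ bits (den w c ρ M) := by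
  induction c with
  | skip => exact fun ρ M => subset_rfl
  | seq c d ihc ihd => exact fun ρ M => (ihc ρ M).trans (ihd ρ _)
  | ifBit τ e c ih =>
    intro ρ M
    simp only [den]
    split_ifs
    · exact ih ρ M
    · exact subset_rfl
  | set i e => exact fun ρ M => by simp [den, bits_set]
  | loop x y c ih =>
    intro ρ M
    simp only [den]
    generalize List.range' 0 (ρ y) = l
    induction l generalizing M with
    | nil => exact subset_rfl
    | cons i l ihl => exact (ih _ M).trans (ihl _)

/-- Tests are positive and tables only grow, so whatever fires against a set of entries present at
the start also fires during the actual execution. Together with `bits_den_subset` this replaces the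
sequential semantics by the order-independent `fires`. -/
theorem fires_subset_bits_den (w : List Bool) (c : Cmd) :
    ∀ (ρ : Fin 10 → ℕ) (M : Fin 6 → List Bool) (Q : Set (Fin 6 × ℕ)), Q ⊆ bits M →
      fires w c ρ Q ⊆ bits (den w c ρ M) := by
  induction c with
  | skip => exact fun ρ M Q _ => Set.empty_subset _
  | seq c d ihc ihd =>
    exact fun ρ M Q hQ => Set.union_subset ((ihc ρ M Q hQ).trans (bits_subset_den w d ρ _))
      (ihd ρ _ Q (hQ.trans (bits_subset_den w c ρ M)))
  | ifBit τ e c ih =>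
    rintro ρ M Q hQ z ⟨hz₁, hz₂⟩
    simp only [den]
    rw [if_pos ((holds_bits w M _ τ).1 (hz₁.mono hQ))]
    exact ih ρ M Q hQ hz₂
  | set i e => exact fun ρ M Q _ => by simp [den, bits_set, fires]
  | loop x y c ih =>
    rintro ρ M Q hQ z ⟨i, hi, hz⟩
    have hi' : i ∈ List.range' 0 (ρ y) := by simpa using hi
    simp only [den]
    generalize List.range' 0 (ρ y) = l at hi'
    induction l generalizing M with
    | nil => simp at hi'
    | cons j l ihl =>
      rcases List.mem_cons.1 hi' with rfl | h
      -- The entry is set in the present round; the later rounds do not erase it.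
      · have hsub : ∀ M, bits M ⊆ bits (l.foldl (fun M i => den w c (update ρ x i) M) M) := by
          clear ihl hi'
          induction l with
          | nil => exact fun M => subset_rfl
          | cons i l ihl => exact fun M => (bits_subset_den w c _ M).trans (ihl _)
        exact hsub _ (ih _ M Q hQ hz)
      · exact ihl _ (hQ.trans (bits_subset_den w c _ M)) h

/-- A set closed under `fires` is an invariant of the execution: each entry set has passed tests in
tables contained in `Q`, hence fires against `Q` and lies in it. -/
theorem bits_den_subset (w : List Bool) (c : Cmd) :
    ∀ (ρ : Fin 10 → ℕ) (M : Fin 6 → List Bool) (Q : Set (Fin 6 × ℕ)), bits M ⊆ Q →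
      fires w c ρ Q ⊆ Q → bits (den w c ρ M) ⊆ Q := by
  induction c with
  | skip => exact fun ρ M Q hQ _ => hQ
  | seq c d ihc ihd =>
    exact fun ρ M Q hQ hf => ihd ρ _ Q (ihc ρ M Q hQ (Set.subset_union_left.trans hf))
      (Set.subset_union_right.trans hf)
  | ifBit τ e c ih =>
    intro ρ M Q hQ hf
    simp only [den]
    split_ifs with h
    · exact ih ρ M Q hQ fun z hz => hf ⟨((holds_bits w M _ τ).2 h).mono hQ, hz⟩
    · exact hQ
  | set i e =>
    intro ρ M Q hQ hf
    simp only [den, bits_set]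
    exact Set.insert_subset (hf rfl) hQ
  | loop x y c ih =>
    intro ρ M Q hQ hf
    simp only [den]
    have hf' : ∀ i ∈ List.range' 0 (ρ y), fires w c (update ρ x i) Q ⊆ Q :=
      fun i hi z hz => hf ⟨i, by simpa using hi, hz⟩
    generalize List.range' 0 (ρ y) = l at hf'
    induction l generalizing M with
    | nil => exact hQ
    | cons i l ihl =>
      exact ihl _ (ih _ M Q hQ (hf' i (by simp))) fun j hj => hf' j (by simp [hj])

/-- The tables contain `I`, are contained in `C`, and have at least `r` entries unless they equal
`C`: the progress after `r` rounds of a saturation procedure. -/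
def Progress (I C : Set (Fin 6 × ℕ)) (r : ℕ) (M : Fin 6 → List Bool) : Prop :=
  I ⊆ bits M ∧ bits M ⊆ C ∧ (C ⊆ bits M ∨ r ≤ (bits M).ncard)

/-- The hypotheses make `C` the least set that contains `I` and is closed under the command. An
execution that adds nothing shows that the present entries are closed, so they already contain `C`;
any other execution raises their number. -/
theorem Progress.den {w : List Bool} {I C : Set (Fin 6 × ℕ)} {c : Cmd} {ρ : Fin 10 → ℕ}
    (hC : C.Finite) (h₁ : fires w c ρ C ⊆ C)
    (h₂ : ∀ Q, I ⊆ Q → Q ⊆ C → fires w c ρ Q ⊆ Q → C ⊆ Q) {r : ℕ} {M : Fin 6 → List Bool}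
    (h : Progress I C r M) : Progress I C (r + 1) (c.den w ρ M) := by
  obtain ⟨hI, hM, h⟩ := h
  have hmono := bits_subset_den w c ρ M
  have hsub := bits_den_subset w c ρ M C hM h₁
  refine ⟨hI.trans hmono, hsub, ?_⟩
  rcases h with h | h
  · exact .inl (h.trans hmono)
  · by_cases heq : bits (c.den w ρ M) ⊆ bits M
    · exact .inl ((h₂ _ hI hM
        ((fires_subset_bits_den w c ρ M _ subset_rfl).trans heq)).trans hmono)
    · exact .inr (h.trans_lt (Set.ncard_lt_ncard ⟨hmono, heq⟩ (hC.subset hsub)))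

theorem Progress.den_loop {w : List Bool} {I C : Set (Fin 6 × ℕ)} {c : Cmd} {ρ : Fin 10 → ℕ}
    {x y : Fin 10} {d n : ℕ} (hy : ρ y = n)
    (hc : ∀ i r M, Progress I C r M → Progress I C (r + d) (c.den w (update ρ x i) M))
    {r : ℕ} {M : Fin 6 → List Bool} (h : Progress I C r M) :
    Progress I C (r + n * d) ((Cmd.loop x y c).den w ρ M) := by
  simp only [Cmd.den, hy]
  have key : ∀ (l : List ℕ) (r : ℕ) (M : Fin 6 → List Bool), Progress I C r M →
      Progress I C (r + l.length * d)
        (l.foldl (fun M i => Cmd.den w c (update ρ x i) M) M) := by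
    intro l
    induction l with
    | nil => exact fun r M h => by simpa using h
    | cons i l ih =>
      intro r M h
      have := ih _ _ (hc i r M h)
      rwa [List.length_cons, show r + (l.length + 1) * d = r + d + l.length * d by ring]
  simpa using key (List.range' 0 n) r M h

/-- Execute a command a fixed number of times. -/
def rounds (c : Cmd) : ℕ → Cmd
  | 0 => skip
  | n + 1 => seq c (rounds c n)

theorem Progress.den_rounds {w : List Bool} {I C : Set (Fin 6 × ℕ)} {c : Cmd} {ρ : Fin 10 → ℕ}
    {d : ℕ} (hc : ∀ r M, Progress I C r M → Progress I C (r + d) (c.den w ρ M)) (n : ℕ) :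
    ∀ {r : ℕ} {M : Fin 6 → List Bool}, Progress I C r M →
      Progress I C (r + n * d) ((c.rounds n).den w ρ M) := by
  induction n with
  | zero => exact fun h => by simpa [rounds, Cmd.den] using h
  | succ n ih =>
    intro r M h
    have := ih (hc r M h)
    rwa [show r + (n + 1) * d = r + d + n * d by ring]

theorem Progress.subset {I C : Set (Fin 6 × ℕ)} (hC : C.Finite) {r : ℕ} {M : Fin 6 → List Bool}
    (h : Progress I C r M) (hr : C.ncard ≤ r) : bits M = C := by
  obtain ⟨_, hM, h | h⟩ := h
  · exact hM.antisymm h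
  · exact Set.eq_of_subset_of_ncard_le hM (hr.trans h) hC

end Cmd


/-! ### Positions of bits in the description of an automaton -/

open Function

section Bits

theorem getD_flatMap_finRange {α : Type*} (d : α) {L : ℕ} (n : ℕ) (f : Fin n → List α)
    (hf : ∀ p, (f p).length = L) (p : Fin n) {i : ℕ} (hi : i < L) :
    ((List.finRange n).flatMap f).getD (p * L + i) d = (f p).getD i d := by
  induction n with
  | zero => exact p.elim0
  | succ n ih =>
    rw [List.finRange_succ, List.flatMap_cons, List.flatMap_map]
    refine Fin.cases ?_ (fun p => ?_) p
    · rw [Fin.val_zero, zero_mul, zero_add, List.getD_append _ _ _ _ (by rw [hf]; exact hi)]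
    · rw [Fin.val_succ, List.getD_append_right _ _ _ _ (by rw [hf]; ring_nf; omega), hf,
        show (p + 1) * L + i - L = p * L + i by rw [Nat.succ_mul]; omega]
      exact ih (fun p => f p.succ) (fun p => hf _) p

theorem length_flatMap_finRange {α : Type*} {L : ℕ} (n : ℕ) (f : Fin n → List α)
    (hf : ∀ p, (f p).length = L) : ((List.finRange n).flatMap f).length = n * L := by
  simp [List.length_flatMap, hf]

theorem length_setBits {n : ℕ} (s : Set (Fin n)) : (SDI.setBits s).length = n := by
  simp [SDI.setBits]

theorem getD_setBits {n : ℕ} (s : Set (Fin n)) (q : Fin n) :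
    (SDI.setBits s).getD q false = true ↔ q ∈ s := by
  simp [SDI.setBits, List.getD_eq_getElem?_getD]

variable {k n m : ℕ}

theorem length_nfaBits (M : NFA (Fin k) (Fin n)) :
    (SDI.nfaBits M).length = n * (k * n) + (n + n) := by
  have h : ∀ p, ((List.finRange k).flatMap fun a => SDI.setBits (M.step p a)).length = k * n :=
    fun p => length_flatMap_finRange k _ fun a => length_setBits _
  rw [SDI.nfaBits, List.length_append, List.length_append, length_flatMap_finRange n _ h,
    length_setBits, length_setBits, add_assoc]

theorem getD_nfaBits_step (M : NFA (Fin k) (Fin n)) (l : List Bool) (p p' : Fin n) (a : Fin k) :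
    (SDI.nfaBits M ++ l).getD (p * (k * n) + (a * n + p')) false = true ↔ p' ∈ M.step p a := by
  have h : ∀ p, ((List.finRange k).flatMap fun a => SDI.setBits (M.step p a)).length = k * n :=
    fun p => length_flatMap_finRange k _ fun a => length_setBits _
  have ha : (a : ℕ) * n + p' < k * n := by
    have h₁ : ((a : ℕ) + 1) * n ≤ k * n := Nat.mul_le_mul_right n a.2
    have h₂ := p'.2
    rw [Nat.succ_mul] at h₁
    omega
  have hp : (p : ℕ) * (k * n) + (a * n + p') < n * (k * n) := by
    have h₁ : ((p : ℕ) + 1) * (k * n) ≤ n * (k * n) := Nat.mul_le_mul_right _ p.2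
    rw [Nat.succ_mul] at h₁
    omega
  rw [SDI.nfaBits, List.append_assoc, List.append_assoc, List.getD_append _ _ _ _
    (by rwa [length_flatMap_finRange n _ h]), getD_flatMap_finRange _ n _ h p ha,
    getD_flatMap_finRange _ k _ (fun a => length_setBits _) a p'.2, getD_setBits]

theorem getD_nfaBits_start (M : NFA (Fin k) (Fin n)) (l : List Bool) (p : Fin n) :
    (SDI.nfaBits M ++ l).getD (n * (k * n) + p) false = true ↔ p ∈ M.start := by
  have h : ∀ p, ((List.finRange k).flatMap fun a => SDI.setBits (M.step p a)).length = k * n :=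
    fun p => length_flatMap_finRange k _ fun a => length_setBits _
  rw [SDI.nfaBits, List.append_assoc, List.append_assoc, List.getD_append_right _ _ _ _
    (by rw [length_flatMap_finRange n _ h]; omega), length_flatMap_finRange n _ h,
    Nat.add_sub_cancel_left, List.getD_append _ _ _ _ (by rw [length_setBits]; exact p.2),
    getD_setBits]

theorem getD_nfaBits_accept (M : NFA (Fin k) (Fin n)) (l : List Bool) (p : Fin n) :
    (SDI.nfaBits M ++ l).getD (n * (k * n) + (n + p)) false = true ↔ p ∈ M.accept := by
  have h : ∀ p, ((List.finRange k).flatMap fun a => SDI.setBits (M.step p a)).length = k * n :=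
    fun p => length_flatMap_finRange k _ fun a => length_setBits _
  rw [SDI.nfaBits, List.append_assoc, List.append_assoc, List.getD_append_right _ _ _ _
    (by rw [length_flatMap_finRange n _ h]; omega), length_flatMap_finRange n _ h,
    Nat.add_sub_cancel_left, List.getD_append_right _ _ _ _ (by rw [length_setBits]; omega),
    length_setBits, Nat.add_sub_cancel_left,
    List.getD_append _ _ _ _ (by rw [length_setBits]; exact p.2), getD_setBits]

theorem getD_nfaBits_append (M : NFA (Fin k) (Fin n)) (l : List Bool) (i : ℕ) :
    (SDI.nfaBits M ++ l).getD (n * (k * n) + (n + (n + i))) false = l.getD i false := by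
  rw [List.getD_append_right _ _ _ _ (by rw [length_nfaBits]; omega), length_nfaBits]
  congr 1
  omega

end Bits

/-! ### The product graph and the command that searches it -/

/-- The kinds of moves in the product of two automata: the first automaton, the second one, both
of them on a common letter, or none of them moves. -/
inductive Kind : Type
  | left | right | both | none
  deriving DecidableEq

/-- A rule allows the moves of one kind from a first to a second phase. -/
abbrev Rule := Kind × Fin 6 × Fin 6

section Reach

variable {k n m : ℕ} (A : NFA (Fin k) (Fin n)) (B : NFA (Fin k) (Fin m))

/-- The moves in the product of two automata. -/
def Move (p : Fin n) (q : Fin m) (p' : Fin n) (q' : Fin m) : Kind → Prop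
  | .left => (∃ a, p' ∈ A.step p a) ∧ q' = q
  | .right => p' = p ∧ ∃ a, q' ∈ B.step q a
  | .both => ∃ a, p' ∈ A.step p a ∧ q' ∈ B.step q a
  | .none => p' = p ∧ q' = q

/-- The vertices that can be reached from the initial ones in the product of two automata and a set
of phases. -/
inductive Reach (rules : List Rule) : Fin 6 → Fin n → Fin m → Prop
  | start {p q} : p ∈ A.start → q ∈ B.start → Reach rules 0 p q
  | move {κ i j p q p' q'} : (κ, i, j) ∈ rules → Reach rules i p q → Move A B p q p' q' κ →
      Reach rules j p' q'

end Reach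

namespace Cmd

/-- The bit of the transition table of the first automaton for the states `x₃`, `x₄` and the
letter `x₇`, where the variables `x₀`, `x₁`, `x₂` hold the number of letters and the numbers of
states. -/
def stepLeft : Expr := [[3, 0, 1], [7, 1], [4]]

/-- The length of the description of the first automaton. -/
def offset : Expr := [[1, 0, 1], [1], [1]]

/-- The bit of the transition table of the second automaton for the states `x₅`, `x₆` and the
letter `x₇`. -/
def stepRight : Expr := offset ++ [[5, 0, 2], [7, 2], [6]]

/-- The number of a pair of states. -/
def pair (x y : Fin 10) : Expr := [[x, 2], [y]]

/-- The command that applies a rule to all pairs of states. -/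
def applyRule (i j : Fin 6) : Kind → Cmd
  | .left => loop 3 1 <| loop 4 1 <| loop 5 2 <| loop 7 0 <| ifBit none stepLeft <|
      ifBit (some i) (pair 3 5) <| set j (pair 4 5)
  | .right => loop 3 1 <| loop 5 2 <| loop 6 2 <| loop 7 0 <| ifBit none stepRight <|
      ifBit (some i) (pair 3 5) <| set j (pair 3 6)
  | .both => loop 3 1 <| loop 4 1 <| loop 5 2 <| loop 6 2 <| loop 7 0 <| ifBit none stepLeft <|
      ifBit none stepRight <| ifBit (some i) (pair 3 5) <| set j (pair 4 6)
  | .none => loop 3 1 <| loop 5 2 <| ifBit (some i) (pair 3 5) <| set j (pair 3 5)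

/-- Apply all rules once. -/
def sweep : List Rule → Cmd
  | [] => skip
  | r :: l => seq (applyRule r.2.1 r.2.2 r.1) (sweep l)

/-- Mark the initial pairs of states. -/
def markStart : Cmd :=
  loop 3 1 <| loop 5 2 <| ifBit none [[1, 0, 1], [3]] <|
    ifBit none (offset ++ [[2, 0, 2], [5]]) <| set 0 (pair 3 5)

/-- Test whether a final pair of states is marked. -/
def testAccept (f : Fin 6) : Cmd :=
  loop 3 1 <| loop 5 2 <| ifBit none [[1, 0, 1], [1], [3]] <|
    ifBit none (offset ++ [[2, 0, 2], [2], [5]]) <| ifBit (some f) (pair 3 5) <| set 5 []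

/-- Saturation of the reachable vertices of the product of two automata. -/
def search (rules : List Rule) (f : Fin 6) : Cmd :=
  seq markStart (seq (rounds (loop 8 1 (loop 9 2 (sweep rules))) 6) (testAccept f))

theorem bound_applyRule (i j : Fin 6) (κ : Kind) : (applyRule i j κ).bound ⊆ {3, 4, 5, 6, 7} := by
  cases κ <;> simp only [applyRule, bound] <;> decide

theorem bound_sweep (rules : List Rule) : (sweep rules).bound ⊆ {3, 4, 5, 6, 7} := by
  induction rules with
  | nil => simp [sweep, bound]
  | cons r l ih => exact Finset.union_subset (bound_applyRule _ _ _) ih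

theorem wellFormed_sweep (rules : List Rule) : (sweep rules).WellFormed := by
  induction rules with
  | nil => trivial
  | cons r l ih =>
    refine ⟨?_, ih⟩
    rcases r with ⟨_ | _, i, j⟩ <;> simp only [applyRule, WellFormed, bound] <;> decide

theorem bound_rounds (c : Cmd) (n : ℕ) : (rounds c n).bound ⊆ c.bound := by
  induction n with
  | zero => simp [rounds, bound]
  | succ n ih => exact Finset.union_subset subset_rfl ih

theorem WellFormed.rounds {c : Cmd} (hc : c.WellFormed) (n : ℕ) : (c.rounds n).WellFormed := by
  induction n with
  | zero => trivial
  | succ n ih => exact ⟨hc, ih⟩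

theorem wellFormed_search (rules : List Rule) (f : Fin 6) : (search rules f).WellFormed := by
  refine ⟨?_, WellFormed.rounds (c := loop 8 1 (loop 9 2 (sweep rules)))
    ⟨?_, ?_, wellFormed_sweep rules⟩ 6, ?_⟩
  · simp only [markStart, WellFormed, bound]; decide
  · simp only [bound, Finset.mem_insert, not_or]
    exact ⟨by decide, fun h => absurd (bound_sweep rules h) (by decide)⟩
  · exact fun h => absurd (bound_sweep rules h) (by decide)
  · simp only [testAccept, WellFormed, bound]; decide

theorem bound_search (rules : List Rule) (f : Fin 6) :
    (search rules f).bound ⊆ {3, 4, 5, 6, 7, 8, 9} := by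
  refine Finset.union_subset ?_ (Finset.union_subset ((bound_rounds _ 6).trans ?_) ?_)
  · simp only [markStart, bound]; decide
  · exact Finset.insert_subset (by decide) (Finset.insert_subset (by decide)
      ((bound_sweep rules).trans (by decide)))
  · simp only [testAccept, bound]; decide

section Correctness

variable {k n m : ℕ} (A : NFA (Fin k) (Fin n)) (B : NFA (Fin k) (Fin m)) {ρ : Fin 10 → ℕ}

theorem exists_lt_iff_exists_fin {n : ℕ} {P : ℕ → Prop} :
    (∃ i < n, P i) ↔ ∃ i : Fin n, P i :=
  ⟨fun ⟨i, hi, h⟩ => ⟨⟨i, hi⟩, h⟩, fun ⟨i, h⟩ => ⟨i, i.2, h⟩⟩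

/-- Here the address polynomials are checked against the encoding. The input is what remains after
the header has been read, so the transition table of `A` begins at position zero and `offset` leads
to that of `B`. -/
theorem mem_fires_applyRule (h₀ : ρ 0 = k) (h₁ : ρ 1 = n) (h₂ : ρ 2 = m) (i j : Fin 6) (κ : Kind)
    (Q : Set (Fin 6 × ℕ)) (z : Fin 6 × ℕ) :
    z ∈ fires (SDI.nfaBits A ++ SDI.nfaBits B) (applyRule i j κ) ρ Q ↔
      ∃ p q p' q', Move A B p q p' q' κ ∧ (i, (p * m + q : ℕ)) ∈ Q ∧
        z = (j, (p' * m + q' : ℕ)) := by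
  have hA := getD_nfaBits_step A (SDI.nfaBits B)
  have hB := fun q q' a => by simpa only [List.append_nil] using getD_nfaBits_step B [] q q' a
  cases κ <;>
    simp [applyRule, fires, Holds, Expr.val, stepLeft, stepRight, pair, offset, h₀, h₁, h₂, Move,
      exists_lt_iff_exists_fin, hA, hB, getD_nfaBits_append, -List.getD_eq_getElem?_getD] <;>
    grind

theorem mem_fires_sweep (h₀ : ρ 0 = k) (h₁ : ρ 1 = n) (h₂ : ρ 2 = m) (rules : List Rule)
    (Q : Set (Fin 6 × ℕ)) (z : Fin 6 × ℕ) :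
    z ∈ fires (SDI.nfaBits A ++ SDI.nfaBits B) (sweep rules) ρ Q ↔
      ∃ κ i j p q p' q', (κ, i, j) ∈ rules ∧ Move A B p q p' q' κ ∧ (i, (p * m + q : ℕ)) ∈ Q ∧
        z = (j, (p' * m + q' : ℕ)) := by
  induction rules with
  | nil => simp [sweep, fires]
  | cons r l ih =>
    obtain ⟨κ, i, j⟩ := r
    simp only [sweep, fires, Set.mem_union, ih, mem_fires_applyRule A B h₀ h₁ h₂, List.mem_cons]
    constructor
    · rintro (⟨p, q, p', q', h⟩ | ⟨κ, i, j, p, q, p', q', h, h'⟩)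
      · exact ⟨κ, i, j, p, q, p', q', .inl rfl, h⟩
      · exact ⟨κ, i, j, p, q, p', q', .inr h, h'⟩
    · rintro ⟨κ', i', j', p, q, p', q', h | h, h'⟩
      · obtain ⟨rfl, rfl, rfl⟩ : κ' = κ ∧ i' = i ∧ j' = j := by simpa using h
        exact .inl ⟨p, q, p', q', h'⟩
      · exact .inr ⟨κ', i', j', p, q, p', q', h, h'⟩

theorem mem_fires_markStart (h₀ : ρ 0 = k) (h₁ : ρ 1 = n) (h₂ : ρ 2 = m)
    (Q : Set (Fin 6 × ℕ)) (z : Fin 6 × ℕ) :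
    z ∈ fires (SDI.nfaBits A ++ SDI.nfaBits B) markStart ρ Q ↔
      ∃ p q, p ∈ A.start ∧ q ∈ B.start ∧ z = (0, (p * m + q : ℕ)) := by
  have hA := getD_nfaBits_start A (SDI.nfaBits B)
  have hB := fun q => by simpa only [List.append_nil] using getD_nfaBits_start B [] q
  simp [markStart, fires, Holds, Expr.val, pair, offset, h₀, h₁, h₂,
      exists_lt_iff_exists_fin, hA, hB, getD_nfaBits_append, -List.getD_eq_getElem?_getD]

theorem mem_fires_testAccept (h₀ : ρ 0 = k) (h₁ : ρ 1 = n) (h₂ : ρ 2 = m) (f : Fin 6)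
    (Q : Set (Fin 6 × ℕ)) (z : Fin 6 × ℕ) :
    z ∈ fires (SDI.nfaBits A ++ SDI.nfaBits B) (testAccept f) ρ Q ↔
      ∃ p q, p ∈ A.accept ∧ q ∈ B.accept ∧ (f, (p * m + q : ℕ)) ∈ Q ∧ z = (5, 0) := by
  have hA := getD_nfaBits_accept A (SDI.nfaBits B)
  have hB := fun q => by simpa only [List.append_nil] using getD_nfaBits_accept B [] q
  simp [testAccept, fires, Holds, Expr.val, pair, offset, h₀, h₁, h₂,
      exists_lt_iff_exists_fin, hA, hB, getD_nfaBits_append, -List.getD_eq_getElem?_getD]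

/-- The table entries that stand for the reachable vertices. -/
def reachable (rules : List Rule) : Set (Fin 6 × ℕ) :=
  {z | ∃ p q, Reach A B rules z.1 p q ∧ z.2 = p * m + q}

/-- Division with remainder by `m` recovers the pair from its number, so a table entry stands for
only one vertex. -/
theorem mem_reachable (rules : List Rule) (i : Fin 6) (p : Fin n) (q : Fin m) :
    (i, (p * m + q : ℕ)) ∈ reachable A B rules ↔ Reach A B rules i p q := by
  refine ⟨?_, fun h => ⟨p, q, h, rfl⟩⟩
  rintro ⟨p', q', h, he⟩
  have hm : 0 < m := q.pos
  have hq : q = q' := by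
    have := congrArg (· % m) he
    simp only [Nat.mul_comm _ m, Nat.mul_add_mod] at this
    rw [Nat.mod_eq_of_lt q.2, Nat.mod_eq_of_lt q'.2] at this
    exact Fin.ext this
  subst hq
  have hp : p = p' := Fin.ext (Nat.eq_of_mul_eq_mul_right hm (Nat.add_right_cancel he))
  exact hp ▸ h

theorem reachable_finite (rules : List Rule) :
    (reachable A B rules).Finite ∧ (reachable A B rules).ncard ≤ 6 * (n * m) := by
  have hsub : reachable A B rules ⊆
      Set.range fun v : Fin 6 × Fin n × Fin m => (v.1, (v.2.1 * m + v.2.2 : ℕ)) := by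
    rintro ⟨i, a⟩ ⟨p, q, -, h⟩
    exact ⟨(i, p, q), Prod.ext rfl h.symm⟩
  refine ⟨(Set.finite_range _).subset hsub, (Set.ncard_le_ncard hsub (Set.finite_range _)).trans ?_⟩
  rw [← Set.image_univ]
  refine (Set.ncard_image_le (Set.toFinite _)).trans ?_
  simp [Set.ncard_univ]

/-- Tables `0` to `4` hold the phases and table `5` is reserved for the answer, which explains the
conditions on `f` and on the targets of the rules. -/
theorem mem_bits_den_search (h₀ : ρ 0 = k) (h₁ : ρ 1 = n) (h₂ : ρ 2 = m) (rules : List Rule)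
    (f : Fin 6) (hf : f ≠ 5) (hr : ∀ r ∈ rules, r.2.2 ≠ 5) :
    (5, 0) ∈ bits ((search rules f).den (SDI.nfaBits A ++ SDI.nfaBits B) ρ fun _ => []) ↔
      ∃ p q, Reach A B rules f p q ∧ p ∈ A.accept ∧ q ∈ B.accept := by
  set w := SDI.nfaBits A ++ SDI.nfaBits B with hw
  set C := reachable A B rules with hC
  obtain ⟨hfin, hcard⟩ := reachable_finite A B rules
  simp only [search, den]
  set M₁ := den w markStart ρ fun _ => [] with hM₁
  set M₂ := den w (rounds (loop 8 1 (loop 9 2 (sweep rules))) 6) ρ M₁ with hM₂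
  have hstart : bits M₁ = fires w markStart ρ ∅ := by
    refine Set.Subset.antisymm (bits_den_subset _ _ _ _ _ (fun z hz => by simp [bits] at hz) ?_)
      (fires_subset_bits_den _ _ _ _ _ (Set.empty_subset _))
    intro z
    simp only [hw, mem_fires_markStart A B h₀ h₁ h₂, imp_self]
  have hI : bits M₁ ⊆ C := by
    intro z hz
    rw [hstart, hw, mem_fires_markStart A B h₀ h₁ h₂] at hz
    obtain ⟨p, q, hp, hq, rfl⟩ := hz
    exact ⟨p, q, .start hp hq, rfl⟩
  have hbits : bits M₂ = C := by
    -- The six rounds of the two nested loops perform as many sweeps as the bound in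
    -- `reachable_finite` on the number of vertices.
    refine Progress.subset (I := bits M₁) (r := 0 + 6 * (n * (m * 1))) hfin ?_ (by simpa using hcard)
    refine Progress.den_rounds (fun r M h => ?_) 6 ⟨subset_rfl, hI, .inr (Nat.zero_le _)⟩
    refine Progress.den_loop h₁ (fun a r M h => ?_) h
    refine Progress.den_loop (by simpa using h₂) (fun b r M h => ?_) h
    have e₀ : update (update ρ 8 a) 9 b 0 = k := by simpa
    have e₁ : update (update ρ 8 a) 9 b 1 = n := by simpa
    have e₂ : update (update ρ 8 a) 9 b 2 = m := by simpa
    refine h.den hfin ?_ fun Q hIQ _ hQ => ?_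
    · intro z hz
      rw [hw, mem_fires_sweep A B e₀ e₁ e₂] at hz
      obtain ⟨κ, i, j, p, q, p', q', hκ, hmove, hpq, rfl⟩ := hz
      exact ⟨p', q', .move hκ ((mem_reachable ..).1 hpq) hmove, rfl⟩
    · rintro ⟨i, a⟩ ⟨p, q, hpq, rfl⟩
      dsimp only at hpq ⊢
      induction hpq with
      | start hp hq =>
        refine hIQ ?_
        rw [hstart, hw, mem_fires_markStart A B h₀ h₁ h₂]
        exact ⟨_, _, hp, hq, rfl⟩
      | move hκ _ hmove ih =>
        refine hQ ?_
        rw [hw, mem_fires_sweep A B e₀ e₁ e₂]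
        exact ⟨_, _, _, _, _, _, _, hκ, hmove, ih, rfl⟩
  constructor
  · intro h
    have h5 : ((5 : Fin 6), 0) ∉ C := by
      rintro ⟨p, q, h, -⟩
      generalize hi : ((5 : Fin 6), 0).1 = i at h
      cases h with
      | start => simp at hi
      | move hκ => exact hr _ hκ hi.symm
    -- The answer bit is added to `C` only if an accepting vertex is reachable. This set is closed
    -- under the test because the test reads phase `f ≠ 5` and therefore sees only `C`.
    have hsub := bits_den_subset w (testAccept f) ρ M₂
      (C ∪ {z | z = (5, 0) ∧ ∃ p q, Reach A B rules f p q ∧ p ∈ A.accept ∧ q ∈ B.accept})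
      (hbits.le.trans Set.subset_union_left) (fun z hz => by
        rw [hw, mem_fires_testAccept A B h₀ h₁ h₂] at hz
        obtain ⟨p, q, hp, hq, hpq, rfl⟩ := hz
        rcases hpq with hpq | hpq
        · exact .inr ⟨rfl, p, q, (mem_reachable ..).1 hpq, hp, hq⟩
        · exact absurd (congrArg Prod.fst hpq.1) hf)
    rcases hsub h with h | h
    · exact absurd h h5
    · exact h.2
  · rintro ⟨p, q, hpq, hp, hq⟩
    refine fires_subset_bits_den w (testAccept f) ρ M₂ _ subset_rfl ?_
    rw [hw, mem_fires_testAccept A B h₀ h₁ h₂, hbits]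
    exact ⟨p, q, hp, hq, (mem_reachable ..).2 hpq, rfl⟩

end Correctness

end Cmd


/-! ### Reading words in the automata and along the product graph -/

section Runs

variable {α σ : Type*} {M : NFA α σ}

theorem mem_eval_append_singleton {p p' : σ} {x : List α} {a : α} (hp : p ∈ M.eval x)
    (h : p' ∈ M.step p a) : p' ∈ M.eval (x ++ [a]) := by
  rw [NFA.eval_append_singleton, NFA.mem_stepSet]
  exact ⟨p, hp, h⟩

theorem mem_evalFrom_append {p p'' : σ} {x y : List α} :
    p'' ∈ M.evalFrom {p} (x ++ y) ↔ ∃ p' ∈ M.evalFrom {p} x, p'' ∈ M.evalFrom {p'} y := by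
  rw [NFA.evalFrom_append, NFA.mem_evalFrom_iff_exists]

theorem mem_evalFrom_cons {p p'' : σ} {a : α} {x : List α} :
    p'' ∈ M.evalFrom {p} (a :: x) ↔ ∃ p' ∈ M.step p a, p'' ∈ M.evalFrom {p'} x := by
  rw [NFA.evalFrom_cons, NFA.stepSet_singleton, NFA.mem_evalFrom_iff_exists]

theorem mem_accepts_iff {x : List α} :
    x ∈ M.accepts ↔ ∃ p ∈ M.start, ∃ p' ∈ M.evalFrom {p} x, p' ∈ M.accept := by
  rw [NFA.mem_accepts]
  constructor
  · rintro ⟨p', h, hp'⟩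
    obtain ⟨p, hp, h⟩ := NFA.mem_evalFrom_iff_exists.1 hp'
    exact ⟨p, hp, p', h, ‹_›⟩
  · rintro ⟨p, hp, p', h, hacc⟩
    exact ⟨p', hacc, NFA.mem_evalFrom_iff_exists.2 ⟨p, hp, h⟩⟩

theorem mem_accepts_of_mem_eval {x : List α} {p : σ} (h : p ∈ M.eval x) (hp : p ∈ M.accept) :
    x ∈ M.accepts := ⟨p, hp, h⟩

end Runs

section Reach

variable {k n m : ℕ} {A : NFA (Fin k) (Fin n)} {B : NFA (Fin k) (Fin m)} {rules : List Rule}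
  {i j : Fin 6} {x : List (Fin k)}

theorem Reach.left (hr : (Kind.left, i, i) ∈ rules) {q : Fin m} {p' : Fin n} :
    ∀ {p : Fin n}, Reach A B rules i p q → p' ∈ A.evalFrom {p} x → Reach A B rules i p' q := by
  induction x with
  | nil =>
    intro p h hp
    obtain rfl : p' = p := hp
    exact h
  | cons a x ih =>
    intro p h hp
    obtain ⟨p₁, hp₁, hp⟩ := mem_evalFrom_cons.1 hp
    exact ih (h.move hr ⟨⟨a, hp₁⟩, rfl⟩) hp

theorem Reach.right (hr : (Kind.right, i, i) ∈ rules) {p : Fin n} {q' : Fin m} :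
    ∀ {q : Fin m}, Reach A B rules i p q → q' ∈ B.evalFrom {q} x → Reach A B rules i p q' := by
  induction x with
  | nil =>
    intro q h hq
    obtain rfl : q' = q := hq
    exact h
  | cons a x ih =>
    intro q h hq
    obtain ⟨q₁, hq₁, hq⟩ := mem_evalFrom_cons.1 hq
    exact ih (h.move hr ⟨rfl, a, hq₁⟩) hq

theorem Reach.both (hr : (Kind.both, i, i) ∈ rules) {p' : Fin n} {q' : Fin m} :
    ∀ {p : Fin n} {q : Fin m}, Reach A B rules i p q → p' ∈ A.evalFrom {p} x →
      q' ∈ B.evalFrom {q} x → Reach A B rules i p' q' := by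
  induction x with
  | nil =>
    intro p q h hp hq
    obtain rfl : p' = p := hp
    obtain rfl : q' = q := hq
    exact h
  | cons a x ih =>
    intro p q h hp hq
    obtain ⟨p₁, hp₁, hp⟩ := mem_evalFrom_cons.1 hp
    obtain ⟨q₁, hq₁, hq⟩ := mem_evalFrom_cons.1 hq
    exact ih (h.move hr ⟨a, hp₁, hq₁⟩) hp hq

theorem Reach.both_singleton (hr : (Kind.both, i, j) ∈ rules) {p p' : Fin n} {q q' : Fin m}
    {a : Fin k} (h : Reach A B rules i p q) (hp : p' ∈ A.evalFrom {p} [a])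
    (hq : q' ∈ B.evalFrom {q} [a]) : Reach A B rules j p' q' :=
  h.move hr ⟨a, by simpa using hp, by simpa using hq⟩

theorem Reach.both_ne_nil (hr : (Kind.both, i, j) ∈ rules) (hr' : (Kind.both, j, j) ∈ rules)
    (hx : x ≠ []) {p p' : Fin n} {q q' : Fin m} (h : Reach A B rules i p q)
    (hp : p' ∈ A.evalFrom {p} x) (hq : q' ∈ B.evalFrom {q} x) : Reach A B rules j p' q' := by
  obtain _ | ⟨a, x⟩ := x
  · exact absurd rfl hx
  · obtain ⟨p₁, hp₁, hp⟩ := mem_evalFrom_cons.1 hp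
    obtain ⟨q₁, hq₁, hq⟩ := mem_evalFrom_cons.1 hq
    exact (h.move hr ⟨a, hp₁, hq₁⟩).both hr' hp hq

end Reach

/-! ### Freeness and independence as reachability -/

section Rules

/-- The rules for the freeness problem of site-directed insertion. -/
def freeRules : List Rule :=
  [(.left, 0, 0), (.both, 0, 1), (.both, 1, 1), (.none, 1, 2), (.right, 2, 2), (.both, 2, 3),
    (.both, 3, 3), (.none, 3, 4), (.left, 4, 4)]

/-- The rules for the freeness problem of alphabetic site-directed insertion. -/
def alphabeticFreeRules : List Rule :=
  [(.left, 0, 0), (.both, 0, 1), (.right, 1, 1), (.both, 1, 2), (.left, 2, 2)]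

/-- The rules for the independence problems. -/
def independentRules : List Rule :=
  [(.both, 0, 0), (.both, 0, 1), (.right, 1, 1), (.both, 1, 2), (.both, 2, 2)]

variable {k n m : ℕ} {A : NFA (Fin k) (Fin n)} {B : NFA (Fin k) (Fin m)}

/-- The phase records which factors have been begun: those of later phases are still empty, and `u`,
`v` are nonempty once their phases `1`, `3` are entered, since entering costs a common letter. The
`none` moves close a factor of arbitrary length before the next one starts. -/
theorem Reach.words_of_freeRules {i : Fin 6} {p : Fin n} {q : Fin m}
    (h : Reach A B freeRules i p q) :
    ∃ x₁ u z v x₂, p ∈ A.eval (x₁ ++ u ++ v ++ x₂) ∧ q ∈ B.eval (u ++ z ++ v) ∧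
      (i < 4 → x₂ = []) ∧ (i < 3 → v = []) ∧ (i < 2 → z = []) ∧ (i < 1 → u = []) ∧
      (1 ≤ i → u ≠ []) ∧ (3 ≤ i → v ≠ []) := by
  induction h with
  | start hp hq => exact ⟨[], [], [], [], [], by simpa using ⟨hp, hq⟩⟩
  | @move κ i j p q p' q' hκ _ hm ih =>
    obtain ⟨x₁, u, z, v, x₂, hp, hq, h₁, h₂, h₃, h₄, h₅, h₆⟩ := ih
    simp only [freeRules, List.mem_cons, Prod.mk.injEq, List.not_mem_nil, or_false] at hκ
    rcases hκ with ⟨rfl, rfl, rfl⟩ | ⟨rfl, rfl, rfl⟩ | ⟨rfl, rfl, rfl⟩ | ⟨rfl, rfl, rfl⟩ |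
      ⟨rfl, rfl, rfl⟩ | ⟨rfl, rfl, rfl⟩ | ⟨rfl, rfl, rfl⟩ | ⟨rfl, rfl, rfl⟩ | ⟨rfl, rfl, rfl⟩ <;>
      simp at h₁ h₂ h₃ h₄ h₅ h₆ <;> subst_vars
    · obtain ⟨⟨a, hp'⟩, rfl⟩ := hm
      refine ⟨x₁ ++ [a], [], [], [], [], ?_, hq, ?_⟩
      · simpa using mem_eval_append_singleton hp hp'
      · simp
    · obtain ⟨a, hp', hq'⟩ := hm
      refine ⟨x₁, [a], [], [], [], ?_, ?_, ?_⟩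
      · simpa using mem_eval_append_singleton hp hp'
      · simpa using mem_eval_append_singleton hq hq'
      · simp
    · obtain ⟨a, hp', hq'⟩ := hm
      refine ⟨x₁, u ++ [a], [], [], [], ?_, ?_, ?_⟩
      · simpa using mem_eval_append_singleton hp hp'
      · simpa using mem_eval_append_singleton hq hq'
      · simp
    · obtain ⟨rfl, rfl⟩ := hm
      exact ⟨x₁, u, [], [], [], hp, hq, by simpa using h₅⟩
    · obtain ⟨rfl, a, hq'⟩ := hm
      refine ⟨x₁, u, z ++ [a], [], [], hp, ?_, ?_⟩
      · simpa using mem_eval_append_singleton hq hq'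
      · simpa using h₅
    · obtain ⟨a, hp', hq'⟩ := hm
      refine ⟨x₁, u, z, [a], [], ?_, ?_, ?_⟩
      · simpa using mem_eval_append_singleton hp hp'
      · simpa using mem_eval_append_singleton hq hq'
      · simpa using h₅
    · obtain ⟨a, hp', hq'⟩ := hm
      refine ⟨x₁, u, z, v ++ [a], [], ?_, ?_, ?_⟩
      · simpa using mem_eval_append_singleton hp hp'
      · simpa using mem_eval_append_singleton hq hq'
      · simpa using h₅
    · obtain ⟨rfl, rfl⟩ := hm
      exact ⟨x₁, u, z, v, [], hp, hq, by simpa using ⟨h₅, h₆⟩⟩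
    · obtain ⟨⟨a, hp'⟩, rfl⟩ := hm
      refine ⟨x₁, u, z, v, x₂ ++ [a], ?_, hq, ?_⟩
      · simpa using mem_eval_append_singleton hp hp'
      · simpa using ⟨h₅, h₆⟩

theorem isFree_iff {α : Type*} {op : List α → List α → Language α} {L R : Language α} :
    SDI.IsFree op L R ↔ ∀ x ∈ L, ∀ y ∈ R, ∀ w, w ∉ op x y := by
  rw [SDI.IsFree, ← le_bot_iff]
  exact ⟨fun h x hx y hy w hw => h ⟨x, hx, y, hy, hw⟩, fun h w ⟨x, hx, y, hy, hw⟩ =>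
    (h x hx y hy w hw).elim⟩

theorem isIndependent_iff {α : Type*} {op : List α → List α → Language α} {L R : Language α} :
    SDI.IsIndependent op L R ↔ ∀ x ∈ L, ∀ y, y ≠ [] → ∀ w ∈ R, w ∉ op x y := by
  rw [SDI.IsIndependent, ← le_bot_iff]
  exact ⟨fun h x hx y hy w hw hwx => h ⟨⟨x, hx, y, hy, hwx⟩, hw⟩,
    fun h w ⟨⟨x, hx, y, hy, hwx⟩, hw⟩ => (h x hx y hy w hw hwx).elim⟩

theorem isFree_sdi_iff : SDI.IsFree SDI.sdi A.accepts B.accepts ↔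
    ¬ ∃ p q, Reach A B freeRules 4 p q ∧ p ∈ A.accept ∧ q ∈ B.accept := by
  rw [isFree_iff]
  constructor
  · rintro h ⟨p, q, hpq, hp, hq⟩
    obtain ⟨x₁, u, z, v, x₂, hp', hq', -, -, -, -, hu, hv⟩ := hpq.words_of_freeRules
    exact h _ (mem_accepts_of_mem_eval hp' hp) _ (mem_accepts_of_mem_eval hq' hq) _
      ⟨x₁, u, z, v, x₂, rfl, rfl, hu (by decide), hv (by decide), rfl⟩
  · rintro h x hx y hy w ⟨x₁, u, z, v, x₂, rfl, rfl, hu, hv, -⟩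
    obtain ⟨p₀, hp₀, p, hp, hpa⟩ := mem_accepts_iff.1 hx
    obtain ⟨q₀, hq₀, q, hq, hqa⟩ := mem_accepts_iff.1 hy
    simp only [mem_evalFrom_append] at hp hq
    obtain ⟨p₃, ⟨p₂, ⟨p₁, h₁, h₂⟩, h₃⟩, h₄⟩ := hp
    obtain ⟨q₂, ⟨q₁, h₅, h₆⟩, h₇⟩ := hq
    have r₁ := ((Reach.start (rules := freeRules) hp₀ hq₀).left (by decide) h₁).both_ne_nil
      (j := 1) (by decide) (by decide) hu h₂ h₅
    have r₂ := (r₁.move (κ := .none) (j := 2) (by decide) ⟨rfl, rfl⟩).right (by decide) h₆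
    have r₃ := r₂.both_ne_nil (j := 3) (by decide) (by decide) hv h₃ h₇
    have r₄ := (r₃.move (κ := .none) (j := 4) (by decide) ⟨rfl, rfl⟩).left (by decide) h₄
    exact h ⟨p, q, r₄, hpa, hqa⟩

/-- The matched factors are single letters, read on the transitions `0 → 1` and `1 → 2`; phase `1`
can therefore serve for `z` at once. -/
theorem Reach.words_of_alphabeticFreeRules {i : Fin 6} {p : Fin n} {q : Fin m}
    (h : Reach A B alphabeticFreeRules i p q) :
    ∃ x₁ u z v x₂, p ∈ A.eval (x₁ ++ u ++ v ++ x₂) ∧ q ∈ B.eval (u ++ z ++ v) ∧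
      (i < 2 → v = [] ∧ x₂ = []) ∧ (i < 1 → u = [] ∧ z = []) ∧
      (1 ≤ i → ∃ a, u = [a]) ∧ (2 ≤ i → ∃ b, v = [b]) := by
  induction h with
  | start hp hq => exact ⟨[], [], [], [], [], by simpa using ⟨hp, hq⟩⟩
  | @move κ i j p q p' q' hκ _ hm ih =>
    obtain ⟨x₁, u, z, v, x₂, hp, hq, h₁, h₂, h₃, h₄⟩ := ih
    simp only [alphabeticFreeRules, List.mem_cons, Prod.mk.injEq, List.not_mem_nil, or_false] at hκ
    rcases hκ with ⟨rfl, rfl, rfl⟩ | ⟨rfl, rfl, rfl⟩ | ⟨rfl, rfl, rfl⟩ | ⟨rfl, rfl, rfl⟩ |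
      ⟨rfl, rfl, rfl⟩ <;> simp at h₁ h₂ h₃ h₄
    · obtain ⟨⟨rfl, rfl⟩, rfl, rfl⟩ := And.intro h₁ h₂
      obtain ⟨⟨a, hp'⟩, rfl⟩ := hm
      refine ⟨x₁ ++ [a], [], [], [], [], ?_, hq, ?_⟩
      · simpa using mem_eval_append_singleton hp hp'
      · simp
    · obtain ⟨⟨rfl, rfl⟩, rfl, rfl⟩ := And.intro h₁ h₂
      obtain ⟨a, hp', hq'⟩ := hm
      refine ⟨x₁, [a], [], [], [], ?_, ?_, ?_⟩
      · simpa using mem_eval_append_singleton hp hp'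
      · simpa using mem_eval_append_singleton hq hq'
      · simp
    · obtain ⟨⟨rfl, rfl⟩, c, rfl⟩ := And.intro h₁ h₃
      obtain ⟨rfl, a, hq'⟩ := hm
      refine ⟨x₁, [c], z ++ [a], [], [], hp, ?_, ?_⟩
      · simpa using mem_eval_append_singleton hq hq'
      · simp
    · obtain ⟨⟨rfl, rfl⟩, c, rfl⟩ := And.intro h₁ h₃
      obtain ⟨a, hp', hq'⟩ := hm
      refine ⟨x₁, [c], z, [a], [], ?_, ?_, ?_⟩
      · simpa using mem_eval_append_singleton hp hp'
      · simpa using mem_eval_append_singleton hq hq'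
      · simp
    · obtain ⟨⟨c, rfl⟩, d, rfl⟩ := And.intro h₃ h₄
      obtain ⟨⟨a, hp'⟩, rfl⟩ := hm
      refine ⟨x₁, [c], z, [d], x₂ ++ [a], ?_, hq, ?_⟩
      · simpa using mem_eval_append_singleton hp hp'
      · simp

theorem isFree_alphabeticSdi_iff : SDI.IsFree SDI.alphabeticSdi A.accepts B.accepts ↔
    ¬ ∃ p q, Reach A B alphabeticFreeRules 2 p q ∧ p ∈ A.accept ∧ q ∈ B.accept := by
  rw [isFree_iff]
  constructor
  · rintro h ⟨p, q, hpq, hp, hq⟩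
    obtain ⟨x₁, u, z, v, x₂, hp', hq', -, -, hu, hv⟩ := hpq.words_of_alphabeticFreeRules
    obtain ⟨a, rfl⟩ := hu (by decide)
    obtain ⟨b, rfl⟩ := hv (by decide)
    exact h _ (mem_accepts_of_mem_eval hp' hp) _ (mem_accepts_of_mem_eval hq' hq) _
      ⟨x₁, a, z, b, x₂, rfl, rfl, rfl⟩
  · rintro h x hx y hy w ⟨x₁, a, z, b, x₂, rfl, rfl, -⟩
    obtain ⟨p₀, hp₀, p, hp, hpa⟩ := mem_accepts_iff.1 hx
    obtain ⟨q₀, hq₀, q, hq, hqa⟩ := mem_accepts_iff.1 hy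
    simp only [mem_evalFrom_append] at hp hq
    obtain ⟨p₃, ⟨p₂, ⟨p₁, h₁, h₂⟩, h₃⟩, h₄⟩ := hp
    obtain ⟨q₂, ⟨q₁, h₅, h₆⟩, h₇⟩ := hq
    have r₁ := ((Reach.start (rules := alphabeticFreeRules) hp₀ hq₀).left (by decide)
      h₁).both_singleton (j := 1) (by decide) h₂ h₅
    have r₂ := ((r₁.right (by decide) h₆).both_singleton (j := 2) (by decide) h₃ h₇).left
      (by decide) h₄
    exact h ⟨p, q, r₂, hpa, hqa⟩

/-- Now `B` reads the result of the insertion, so `x₁` and `x₂` are also read jointly and only `z`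
separates the two words. -/
theorem Reach.words_of_independentRules {i : Fin 6} {p : Fin n} {q : Fin m}
    (h : Reach A B independentRules i p q) :
    ∃ x₁ u z v x₂, p ∈ A.eval (x₁ ++ u ++ v ++ x₂) ∧ q ∈ B.eval (x₁ ++ u ++ z ++ v ++ x₂) ∧
      (i < 2 → v = [] ∧ x₂ = []) ∧ (i < 1 → u = [] ∧ z = []) ∧
      (1 ≤ i → ∃ a, u = [a]) ∧ (2 ≤ i → ∃ b, v = [b]) := by
  induction h with
  | start hp hq => exact ⟨[], [], [], [], [], by simpa using ⟨hp, hq⟩⟩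
  | @move κ i j p q p' q' hκ _ hm ih =>
    obtain ⟨x₁, u, z, v, x₂, hp, hq, h₁, h₂, h₃, h₄⟩ := ih
    simp only [independentRules, List.mem_cons, Prod.mk.injEq, List.not_mem_nil, or_false] at hκ
    rcases hκ with ⟨rfl, rfl, rfl⟩ | ⟨rfl, rfl, rfl⟩ | ⟨rfl, rfl, rfl⟩ | ⟨rfl, rfl, rfl⟩ |
      ⟨rfl, rfl, rfl⟩ <;> simp at h₁ h₂ h₃ h₄
    · obtain ⟨⟨rfl, rfl⟩, rfl, rfl⟩ := And.intro h₁ h₂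
      obtain ⟨a, hp', hq'⟩ := hm
      refine ⟨x₁ ++ [a], [], [], [], [], ?_, ?_, ?_⟩
      · simpa using mem_eval_append_singleton hp hp'
      · simpa using mem_eval_append_singleton hq hq'
      · simp
    · obtain ⟨⟨rfl, rfl⟩, rfl, rfl⟩ := And.intro h₁ h₂
      obtain ⟨a, hp', hq'⟩ := hm
      refine ⟨x₁, [a], [], [], [], ?_, ?_, ?_⟩
      · simpa using mem_eval_append_singleton hp hp'
      · simpa using mem_eval_append_singleton hq hq'
      · simp
    · obtain ⟨⟨rfl, rfl⟩, c, rfl⟩ := And.intro h₁ h₃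
      obtain ⟨rfl, a, hq'⟩ := hm
      refine ⟨x₁, [c], z ++ [a], [], [], hp, ?_, ?_⟩
      · simpa using mem_eval_append_singleton hq hq'
      · simp
    · obtain ⟨⟨rfl, rfl⟩, c, rfl⟩ := And.intro h₁ h₃
      obtain ⟨a, hp', hq'⟩ := hm
      refine ⟨x₁, [c], z, [a], [], ?_, ?_, ?_⟩
      · simpa using mem_eval_append_singleton hp hp'
      · simpa using mem_eval_append_singleton hq hq'
      · simp
    · obtain ⟨⟨c, rfl⟩, d, rfl⟩ := And.intro h₃ h₄
      obtain ⟨a, hp', hq'⟩ := hm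
      refine ⟨x₁, [c], z, [d], x₂ ++ [a], ?_, ?_, ?_⟩
      · simpa using mem_eval_append_singleton hp hp'
      · simpa using mem_eval_append_singleton hq hq'
      · simp

/-- The first of three implications that form a cycle with `isIndependent_sdi_of_not_reach` and
`isIndependent_alphabeticSdi_of_sdi`, and make both independence problems equivalent to the same
reachability condition. -/
theorem not_reach_of_isIndependent_alphabeticSdi
    (h : SDI.IsIndependent SDI.alphabeticSdi A.accepts B.accepts) :
    ¬ ∃ p q, Reach A B independentRules 2 p q ∧ p ∈ A.accept ∧ q ∈ B.accept := by
  rw [isIndependent_iff] at h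
  rintro ⟨p, q, hpq, hp, hq⟩
  obtain ⟨x₁, u, z, v, x₂, hp', hq', -, -, hu, hv⟩ := hpq.words_of_independentRules
  obtain ⟨a, rfl⟩ := hu (by decide)
  obtain ⟨b, rfl⟩ := hv (by decide)
  exact h _ (mem_accepts_of_mem_eval hp' hp) ([a] ++ z ++ [b]) (by simp) _
    (mem_accepts_of_mem_eval hq' hq) ⟨x₁, a, z, b, x₂, rfl, rfl, rfl⟩

theorem isIndependent_sdi_of_not_reach
    (h : ¬ ∃ p q, Reach A B independentRules 2 p q ∧ p ∈ A.accept ∧ q ∈ B.accept) :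
    SDI.IsIndependent SDI.sdi A.accepts B.accepts := by
  rw [isIndependent_iff]
  rintro x hx y - w hw ⟨x₁, u, z, v, x₂, rfl, rfl, hu, hv, rfl⟩
  -- Only the letters next to `z` stay in the match; the rest of `u` and of `v` is read jointly in
  -- phases `0` and `2`, like `x₁` and `x₂`.
  obtain ⟨u, a, rfl⟩ : ∃ u' a, u = u' ++ [a] :=
    ⟨u.dropLast, u.getLast hu, (List.dropLast_append_getLast hu).symm⟩
  obtain ⟨b, v, rfl⟩ := List.exists_cons_of_ne_nil hv
  rw [← List.singleton_append (l := v)] at hx hw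
  obtain ⟨p₀, hp₀, p, hp, hpa⟩ := mem_accepts_iff.1 hx
  obtain ⟨q₀, hq₀, q, hq, hqa⟩ := mem_accepts_iff.1 hw
  simp only [mem_evalFrom_append] at hp hq
  obtain ⟨p₃, ⟨p₂, ⟨p₁, h₁, p₁', h₁', h₂⟩, p₃', h₃, h₃'⟩, h₄⟩ := hp
  obtain ⟨q₄, ⟨q₃, ⟨q₂, ⟨q₁, k₁, q₁', k₁', k₂⟩, k₃⟩, q₃', k₄, k₄'⟩, k₅⟩ := hq
  have r₁ := (((Reach.start (rules := independentRules) hp₀ hq₀).both (by decide) h₁ k₁).both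
    (by decide) h₁' k₁').both_singleton (j := 1) (by decide) h₂ k₂
  have r₂ := (((r₁.right (by decide) k₃).both_singleton (j := 2) (by decide) h₃ k₄).both
    (by decide) h₃' k₄').both (by decide) h₄ k₅
  exact h ⟨p, q, r₂, hpa, hqa⟩

theorem isIndependent_alphabeticSdi_of_sdi {α : Type*} {L R : Language α}
    (h : SDI.IsIndependent SDI.sdi L R) : SDI.IsIndependent SDI.alphabeticSdi L R := by
  rw [isIndependent_iff] at h ⊢
  rintro x hx y hy w hw ⟨x₁, a, z, b, x₂, hx', hy', hw'⟩
  exact h x hx y hy w hw ⟨x₁, [a], z, [b], x₂, hx', hy', by simp, by simp, hw'⟩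

theorem isIndependent_sdi_iff : SDI.IsIndependent SDI.sdi A.accepts B.accepts ↔
    ¬ ∃ p q, Reach A B independentRules 2 p q ∧ p ∈ A.accept ∧ q ∈ B.accept :=
  ⟨fun h => not_reach_of_isIndependent_alphabeticSdi (isIndependent_alphabeticSdi_of_sdi h),
    isIndependent_sdi_of_not_reach⟩

theorem isIndependent_alphabeticSdi_iff :
    SDI.IsIndependent SDI.alphabeticSdi A.accepts B.accepts ↔
      ¬ ∃ p q, Reach A B independentRules 2 p q ∧ p ∈ A.accept ∧ q ∈ B.accept :=
  ⟨not_reach_of_isIndependent_alphabeticSdi, fun h =>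
    isIndependent_alphabeticSdi_of_sdi (isIndependent_sdi_of_not_reach h)⟩

end Rules


/-! ### The complete decision program -/

open Prog Function Stack

/-- Read the numbers of letters and states from the input. -/
def readHeader : Prog Stack :=
  seq (move inp (var 0)) (seq (move inp (var 1)) (move inp (var 2)))

/-- The variables hold the number of letters and the numbers of states. -/
def sizes (k n m : ℕ) : Fin 10 → ℕ := ![k, n, m, 0, 0, 0, 0, 0, 0, 0]

theorem runsIn_readHeader (k n m : ℕ) (w : List Bool) :
    RunsIn readHeader
      (update (fun _ => []) inp
        (SDI.unaryCode k ++ SDI.unaryCode n ++ SDI.unaryCode m ++ w))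
      (store w (fun _ => []) (sizes k n m) fun _ => 0) (2 * (k + n + m) + 3) := by
  have e : ∀ (k : ℕ) (l : List Bool), SDI.unaryCode k ++ l = unary k ++ false :: l :=
    fun k l => by simp [SDI.unaryCode, unary]
  rw [List.append_assoc, List.append_assoc, e, e, e]
  refine ((runsIn_move (l := false :: (unary n ++ false :: (unary m ++ false :: w))) (by simp)
    (by simp) k _ (by simp)).seq ((runsIn_move (l := false :: (unary m ++ false :: w)) (by simp)
    (by simp) n _ (by simp)).seq (runsIn_move (l := false :: w) (by simp) (by simp) m _
    (by simp)))).of_eq ?_ (by ring_nf; omega)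
  funext z
  cases z with
  | var x => fin_cases x <;> simp [store, sizes]
  | _ => simp [store]

/-- Write the negation of the first entry of the last table on the output stack. -/
def answer : Prog Stack := case (mem 5) (push out true) (push out false) (push out true)

theorem runsIn_answer {S : Stack → List Bool} (hS : S out = []) :
    RunsIn answer S
      (update (update S (mem 5) (S (mem 5)).tail) out [!(S (mem 5)).getD 0 false]) 2 := by
  rcases h : S (mem 5) with _ | ⟨_ | _, l⟩
  · refine (RunsIn.case_nil h (RunsIn.push _ _ _)).of_eq ?_ le_rfl
    have : update S (mem 5) [] = S := by rw [← h, update_eq_self]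
    simp [hS, this]
  · exact (RunsIn.case_false h (RunsIn.push _ _ _)).of_eq (by simp [hS]) le_rfl
  · exact (RunsIn.case_true h (RunsIn.push _ _ _)).of_eq (by simp [hS]) le_rfl

/-- Empty several stacks. -/
def drainAll : List Stack → Prog Stack
  | [] => skip
  | k :: l => seq (drain k) (drainAll l)

/-- The stack `tmp` is excluded because draining uses it as its flag; it is empty between two
drains. -/
theorem runsIn_drainAll (l : List Stack) (hl : tmp ∉ l) (T : ℕ) : ∀ S : Stack → List Bool,
    S tmp = [] → (∀ k, (S k).length ≤ T) →
    RunsIn (drainAll l) S (fun k => if k ∈ l then [] else S k) (l.length * (3 * T + 5) + 1) := by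
  induction l with
  | nil => exact fun S _ _ => (RunsIn.skip S).of_eq (by simp) (by simp)
  | cons k l ih =>
    simp only [List.mem_cons, not_or] at hl
    intro S hS hT
    refine ((runsIn_drain (Ne.symm hl.1) hS).seq (ih hl.2 _ (by simp [hS, hl.1]) ?_)).of_eq ?_ ?_
    · intro z
      by_cases hz : z = k
      · subst hz; simp
      · simpa [hz] using hT z
    · funext z
      by_cases hz : z = k
      · subst hz; simp
      · simp [hz]
    · have := hT k
      rw [List.length_cons, Nat.succ_mul]
      linarith

/-- The program that decides whether no accepting vertex can be reached. -/
noncomputable def decider (rules : List Rule) (f : Fin 6) : Prog Stack :=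
  seq (seq readHeader (seq (Cmd.search rules f).toProg answer))
    (drainAll ((Finset.univ.erase tmp).erase out).toList)

-- A machine must halt with every stack but the output empty, so the answer is followed by a
-- clean-up. `R` bounds the time up to the answer, and the clean-up is polynomial because the stacks
-- then have length at most `N + R.eval N`.
open Classical in
theorem decidableInPolyTime_of_iff_not_reach (P : SDI.NFAPair → Prop) (rules : List Rule)
    (f : Fin 6) (hf : f ≠ 5) (hr : ∀ r ∈ rules, r.2.2 ≠ 5)
    (hP : ∀ I, P I ↔ ¬ ∃ p q, Reach I.A I.B rules f p q ∧ p ∈ I.A.accept ∧ q ∈ I.B.accept) :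
    SDI.DecidableInPolyTime SDI.NFAPair.encode P := by
  obtain ⟨Q, hQ⟩ := Cmd.exists_runsIn_toProg _ (Cmd.wellFormed_search rules f)
  set L := ((Finset.univ.erase tmp).erase out).toList with hL
  set R : Polynomial ℕ := 2 * Polynomial.X + 3 + (Q + 2) with hR
  refine decidableInPolyTime_of_runs _ P (decider rules f) inp out
    (R + ((L.length : Polynomial ℕ) * (3 * (Polynomial.X + R) + 5) + 1)) fun I => ?_
  set N := I.encode.length with hN
  set w := SDI.nfaBits I.A ++ SDI.nfaBits I.B with hw
  set ρ := sizes I.letters I.statesA I.statesB with hρ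
  set S := store w ((Cmd.search rules f).den w ρ fun _ => []) ρ fun _ => 0 with hS
  -- The unary header makes the sizes at most the input length; this is where polynomial in the
  -- sizes becomes polynomial in the length.
  have hsum : I.letters + I.statesA + I.statesB + 3 ≤ N := by
    simp only [hN, SDI.NFAPair.encode, SDI.unaryCode, List.length_append, List.length_replicate,
      List.length_singleton]
    omega
  have hle : ∀ x, ρ x ≤ N := by
    intro x
    fin_cases x <;> simp [hρ, sizes] <;> omega
  have h₁ := runsIn_readHeader I.letters I.statesA I.statesB w
  have h₂ := hQ N w (fun _ => []) ρ (fun _ => 0) hle fun x hx => by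
    have := Cmd.bound_search rules f hx
    fin_cases this <;> simp [hρ, sizes]
  have hrun := h₁.seq (h₂.seq (runsIn_answer (S := S) rfl))
  have henc : SDI.unaryCode I.letters ++ SDI.unaryCode I.statesA ++ SDI.unaryCode I.statesB ++ w =
      I.encode := by simp [SDI.NFAPair.encode, hw]
  rw [henc] at hrun
  replace hrun := hrun.mono (b := R.eval N) (by
    simp only [hR, Polynomial.eval_add, Polynomial.eval_mul, Polynomial.eval_ofNat,
      Polynomial.eval_X]
    omega)
  obtain ⟨t, ht, hrun⟩ := hrun
  -- Initially only the input stack is nonempty, with length `N`, and the run lasts at most `R.eval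
  -- N` steps.
  have hlen : ∀ k, (update (update S (mem 5) (S (mem 5)).tail) out
      [!(S (mem 5)).getD 0 false] k).length ≤ N + R.eval N := by
    intro k
    refine (hrun.length_le k).trans (Nat.add_le_add ?_ ht)
    by_cases hk : k = inp
    · subst hk; simp [hN]
    · simp [hk]
  have hdrain := runsIn_drainAll L (by simp [hL]) _ _ (by simp [hS, store]) hlen
  obtain ⟨t', ht', hall⟩ := RunsIn.seq ⟨t, ht, hrun⟩ hdrain
  refine ⟨t', ht'.trans (by simp), ?_⟩
  change Runs (decider rules f) _ _ _ at hall
  convert hall using 1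
  have hans := Cmd.mem_bits_den_search I.A I.B (ρ := ρ) rfl rfl rfl rules f hf hr
  have hbit : decide (P I) = !(S (mem 5)).getD 0 false := by
    rw [Bool.eq_iff_iff, decide_eq_true_iff, hP, ← hans]
    simp [Cmd.bits, hS, store, hw]
  funext z
  by_cases hz : z = out
  · subst hz
    simp [hL, hbit]
  · by_cases hz' : z = tmp
    · subst hz'
      simp [hL, hS, store]
    · simp [hL, hz, hz']

end StackProg

open StackProg in
theorem theorem1 :
    (SDI.DecidableInPolyTime SDI.NFAPair.encode
        (fun I => SDI.IsFree SDI.sdi I.A.accepts I.B.accepts) ∧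
      SDI.DecidableInPolyTime SDI.NFAPair.encode
        (fun I => SDI.IsIndependent SDI.sdi I.A.accepts I.B.accepts)) ∧
    (SDI.DecidableInPolyTime SDI.NFAPair.encode
        (fun I => SDI.IsFree SDI.alphabeticSdi I.A.accepts I.B.accepts) ∧
      SDI.DecidableInPolyTime SDI.NFAPair.encode
        (fun I => SDI.IsIndependent SDI.alphabeticSdi I.A.accepts I.B.accepts)) :=
  ⟨⟨decidableInPolyTime_of_iff_not_reach _ freeRules 4 (by decide) (by decide)
      fun _ => isFree_sdi_iff,
    decidableInPolyTime_of_iff_not_reach _ independentRules 2 (by decide) (by decide)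
      fun _ => isIndependent_sdi_iff⟩,
    decidableInPolyTime_of_iff_not_reach _ alphabeticFreeRules 2 (by decide) (by decide)
      fun _ => isFree_alphabeticSdi_iff,
    decidableInPolyTime_of_iff_not_reach _ independentRules 2 (by decide) (by decide)
      fun _ => isIndependent_alphabeticSdi_iff⟩
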